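/- Let $(\mathcal V,\otimes,I)$ be a monoidal additive category ($\mathcal V$ is additive and $\otimes$ is additive in each variable) with finite limits and finite colimits, such that $X\otimes-$ and $-\otimes X$ preserve finite colimits for every object $X$. **Definitions.** Let $\mathrm{Calc}^1(\mathcal V)$ be the category whose objects are pairs $(A,\Omega_d)$, where $(A,m,i)$ is a monoid in $\mathcal V$ and $\Omega_d$ is a first order differential calculus over $A$, that is, an $A$-bimodule with a morphism $d\colon A\to\Omega_d$ in $\mathcal V$ such that $d\circ m=d\cdot 1_A+1_A\cdot d$ and such that $1_A\cdot d\colon A\otimes A\to\Omega_d$ is an epimorphism in $\mathcal V$. A morphism $(A,\Omega_d)\to(A',\Omega_{d'})$ is a pair $(f,g)$ of a monoid morphism $f\colon A\to A'$ and an $A$-bimodule morphism $g\colon\Omega_d\to f^*\Omega_{d'}$ with $g\circ d=d'\circ f$. A monoid in the category of non-negatively graded cochain complexes in $\mathcal V$ (a dg-algebra) consists of a cochain complex $(\Omega^n,d^n)_{n\ge 0}$, a unit $\eta\colon I\to\Omega^0$ with $d^0\eta=0$, and an associative unital multiplication $\wedge^{i,j}\colon\Omega^i\otimes\Omega^j\to\Omega^{i+j}$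 with $d^{i+j}\wedge^{i,j}=\wedge^{i+1,j}(d^i\otimes 1)+(-1)^i\wedge^{i,j+1}(1\otimes d^j)$. It is a differential calculus if for every $n\ge 0$ the morphism $p_n\colon(\Omega^0)^{\otimes n+1}\to\Omega^n$, $p_n=(1\cdot d^0)\wedge d^0\wedge\dots\wedge d^0$ (informally $a_0\otimes\dots\otimes a_n\mapsto a_0\,da_1\wedge\dots\wedge da_n$, and $p_0=1$), is an epimorphism in $\mathcal V$. Let $\mathrm{Calc}^\bullet(\mathcal V)$ be the full subcategory of the category of dg-algebras on the differential calculi, and let $\pi\colon\mathrm{Calc}^\bullet(\mathcal V)\to\mathrm{Calc}^1(\mathcal V)$ be the truncation functor $\pi(\Omega^\bullet)=(\Omega^0,\Omega^1)$, with multiplication $\wedge^{0,0}$, actions $\wedge^{0,1},\wedge^{1,0}$ and differential $d^0$. The trivial extension $\Omega^\bullet_{d,0}$ of $(A,\Omega_d)$ is the differential calculus with $\Omega^0_{d,0}=A$, $\Omega^1_{d,0}=\Omega_d$, $d^0=d$, and $\Omega^n_{d,0}=0$ for $n\ge 2$. For a monoid $A$ let $\iota^1\colon\Omega^1_u\to A\otimes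 A$ be the kernel of $m$, with the bimodule structure induced from $A\otimes A$ and with $d_u\colon A\to\Omega^1_u$ determined by $\iota^1 d_u=i\otimes 1_A-1_A\otimes i$. Let $\Omega^\bullet_u$ be the dg-algebra with $\Omega^n_u=(\Omega^1_u)^{\otimes_A n}$, with $\wedge_u^{n,m}$ the quotient morphism $\Omega^n_u\otimes\Omega^m_u\to\Omega^n_u\otimes_A\Omega^m_u\cong\Omega^{n+m}_u$, and with differential $d^n_u=\wedge_u\circ d_u^{\otimes n+1}\circ\iota^n$, where $\iota^n=(\iota^1)^{\otimes_A n}\colon\Omega_u^n\to(A\otimes A)^{\otimes_A n}\cong A^{\otimes n+1}$. The maximal prolongation $\Omega^\bullet_{d,max}$ of $(A,\Omega_d)$ is the differential calculus, equipped with a dg-algebra morphism $f\colon\Omega_u^\bullet\to\Omega^\bullet_{d,max}$ with $f^0=1_A$, which is given in degrees $0$ and $1$ by $(A,\Omega_d)$ and, recursively for $n\ge 2$, by the requirement that $\Omega^n_{d,max}$ is the colimit of $$\bigoplus_{i+j=n;\ i,j\ge1}\Omega^i_{d,max}\otimes\Omega^j_{d,max}\xleftarrow{\ \oplus f^i\otimes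 f^j\ }\bigoplus_{i+j=n;\ i,j\ge1}\Omega^i_u\otimes\Omega^j_u\xrightarrow{\ \wedge_u\ }\Omega^n_u\xleftarrow{\ d_u^{n-1}\ }\Omega^{n-1}_u\xrightarrow{\ f^{n-1}\ }\Omega^{n-1}_{d,max},$$ with coprojections $\wedge$, $f^n$ and $d^{n-1}$. **Proposition.** The truncation $\pi\colon\mathrm{Calc}^\bullet(\mathcal V)\to\mathrm{Calc}^1(\mathcal V)$ has 1. a right adjoint, which sends $(A,\Omega_d)$ to the trivial extension $\Omega^\bullet_{d,0}$; 2. a left adjoint, which sends $(A,\Omega_d)$ to the maximal prolongation $\Omega^\bullet_{d,max}$ (in particular the latter exists), the unit of the adjunction being the identification of $(A,\Omega_d)$ with $\pi(\Omega^\bullet_{d,max})$. -/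

import Mathlib

open CategoryTheory MonoidalCategory Limits

open scoped MonObj

universe v u

namespace NCCalc

/-! ### First order differential calculi -/

section FirstOrder

variable (V : Type u) [Category.{v} V] [MonoidalCategory V] [Preadditive V]

/-- An object of `Calc¹(V)`: a monoid `A` in `V` together with a first order differential
calculus over it, i.e. an `A`-bimodule `Ω` and a morphism `d : A ⟶ Ω` of `V` which satisfies the
Leibniz rule `d ∘ m = d · 1 + 1 · d` and for which `1 · d : A ⊗ A ⟶ Ω` is an epimorphism of `V`. -/
structure Calc1 where
  /-- the base monoid -/
  A : Mon V
  /-- the bimodule of one-forms -/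
  Ω : Bimod A A
  /-- the differential -/
  d : A.X ⟶ Ω.X
  leibniz : μ[A.X] ≫ d = d ▷ A.X ≫ Ω.actRight + A.X ◁ d ≫ Ω.actLeft
  surjective : Epi (A.X ◁ d ≫ Ω.actLeft)

variable {V}

namespace Calc1

/-- A morphism `(f, g)` of `Calc¹(V)`: a morphism of monoids `f` and a morphism of bimodules
`g : Ω ⟶ f^* Ω'` (spelled out as compatibility with the two actions) such that `g d = d' f`. -/
@[ext]
structure Hom (X Y : Calc1 V) where
  /-- the morphism of monoids -/
  f : X.A ⟶ Y.A
  /-- the morphism on one-forms -/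
  g : X.Ω.X ⟶ Y.Ω.X
  actLeft_comm : X.Ω.actLeft ≫ g = (f.hom ⊗ₘ g) ≫ Y.Ω.actLeft
  actRight_comm : X.Ω.actRight ≫ g = (g ⊗ₘ f.hom) ≫ Y.Ω.actRight
  d_comm : X.d ≫ g = f.hom ≫ Y.d

/-- The category `Calc¹(V)`. -/
instance : Category (Calc1 V) where
  Hom := Hom
  id X :=
    { f := 𝟙 X.A
      g := 𝟙 X.Ω.X
      actLeft_comm := by simp
      actRight_comm := by simp
      d_comm := by simp }
  comp φ ψ :=
    { f := φ.f ≫ ψ.f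
      g := φ.g ≫ ψ.g
      actLeft_comm := by
        rw [← Category.assoc, φ.actLeft_comm, Category.assoc, ψ.actLeft_comm,
          ← Category.assoc, tensorHom_comp_tensorHom]
        rfl
      actRight_comm := by
        rw [← Category.assoc, φ.actRight_comm, Category.assoc, ψ.actRight_comm,
          ← Category.assoc, tensorHom_comp_tensorHom]
        rfl
      d_comm := by
        rw [← Category.assoc, φ.d_comm, Category.assoc, ψ.d_comm, ← Category.assoc]
        rfl }
  id_comp φ := Hom.ext (Category.id_comp φ.f) (Category.id_comp φ.g)
  comp_id φ := Hom.ext (Category.comp_id φ.f) (Category.comp_id φ.g)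
  assoc φ ψ χ := Hom.ext (Category.assoc φ.f ψ.f χ.f) (Category.assoc φ.g ψ.g χ.g)

/-- In a first order differential calculus the unit of the monoid is closed. -/
lemma one_d (X : Calc1 V) : η[X.A.X] ≫ X.d = 0 := by
  have h := congrArg (fun t => (λ_ (𝟙_ V)).inv ≫ (η[X.A.X] ⊗ₘ η[X.A.X]) ≫ t) X.leibniz
  have h1 : (λ_ (𝟙_ V)).inv ≫ (η[X.A.X] ⊗ₘ η[X.A.X]) ≫ μ[X.A.X] ≫ X.d = η[X.A.X] ≫ X.d := by
    simp [tensorHom_def']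
  have h2 : (λ_ (𝟙_ V)).inv ≫ (η[X.A.X] ⊗ₘ η[X.A.X]) ≫ X.d ▷ X.A.X ≫ X.Ω.actRight =
      η[X.A.X] ≫ X.d := by
    rw [tensorHom_def_assoc, whisker_exchange_assoc, Bimod.actRight_one, ← comp_whiskerRight_assoc,
      rightUnitor_naturality, ← unitors_equal, Iso.inv_hom_id_assoc]
  have h3 : (λ_ (𝟙_ V)).inv ≫ (η[X.A.X] ⊗ₘ η[X.A.X]) ≫ X.A.X ◁ X.d ≫ X.Ω.actLeft =
      η[X.A.X] ≫ X.d := by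
    rw [tensorHom_def'_assoc, ← whisker_exchange_assoc, Bimod.one_actLeft,
      ← MonoidalCategory.whiskerLeft_comp_assoc, leftUnitor_naturality, Iso.inv_hom_id_assoc]
  simp only [Preadditive.comp_add] at h
  rw [h1, h2, h3] at h
  simpa using h

end Calc1

end FirstOrder

/-! ### Monoids in cochain complexes (dg-algebras) -/

section DG

variable (V : Type u) [Category.{v} V] [MonoidalCategory V] [Preadditive V]

/-- A monoid in the monoidal category of non-negatively graded cochain complexes in `V`, given by
the components `⋀ i j : Kⁱ ⊗ Kʲ ⟶ Kⁱ⁺ʲ` of its multiplication (the target degree `n` is carried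
along with a proof of `i + j = n`) and the degree zero component of its unit. -/
structure DGAlgebra where
  /-- the underlying cochain complex -/
  K : CochainComplex V ℕ
  /-- the unit -/
  one : 𝟙_ V ⟶ K.X 0
  /-- the multiplication -/
  wedge (i j n : ℕ) (h : i + j = n) : K.X i ⊗ K.X j ⟶ K.X n
  one_d : one ≫ K.d 0 1 = 0
  one_wedge (n : ℕ) : one ▷ K.X n ≫ wedge 0 n n (zero_add n) = (λ_ (K.X n)).hom
  wedge_one (n : ℕ) : K.X n ◁ one ≫ wedge n 0 n (add_zero n) = (ρ_ (K.X n)).hom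
  wedge_assoc (i j k ij jk n : ℕ) (hij : i + j = ij) (hjk : j + k = jk)
    (h : ij + k = n) (h' : i + jk = n) :
    wedge i j ij hij ▷ K.X k ≫ wedge ij k n h =
      (α_ (K.X i) (K.X j) (K.X k)).hom ≫ K.X i ◁ wedge j k jk hjk ≫ wedge i jk n h'
  leibniz (i j n : ℕ) (h : i + j = n) :
    wedge i j n h ≫ K.d n (n + 1) =
      K.d i (i + 1) ▷ K.X j ≫ wedge (i + 1) j (n + 1) (by omega) +
        (-1 : ℤ) ^ i • (K.X i ◁ K.d j (j + 1) ≫ wedge i (j + 1) (n + 1) (by omega))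

variable {V}

namespace DGAlgebra

/-- A morphism of monoids in cochain complexes. -/
@[ext]
structure Hom (M N : DGAlgebra V) where
  /-- the underlying morphism of cochain complexes -/
  φ : M.K ⟶ N.K
  one_comm : M.one ≫ φ.f 0 = N.one
  wedge_comm (i j n : ℕ) (h : i + j = n) :
    M.wedge i j n h ≫ φ.f n = (φ.f i ⊗ₘ φ.f j) ≫ N.wedge i j n h

/-- The category of monoids in cochain complexes. -/
instance : Category (DGAlgebra V) where
  Hom := Hom
  id M :=
    { φ := 𝟙 M.K
      one_comm := by simp
      wedge_comm := by simp }
  comp F G :=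
    { φ := F.φ ≫ G.φ
      one_comm := by
        rw [HomologicalComplex.comp_f, ← Category.assoc, F.one_comm, G.one_comm]
      wedge_comm := fun i j n h => by
        rw [HomologicalComplex.comp_f, ← Category.assoc, F.wedge_comm, Category.assoc,
          G.wedge_comm, ← Category.assoc, tensorHom_comp_tensorHom]
        rfl }
  id_comp F := Hom.ext (Category.id_comp F.φ)
  comp_id F := Hom.ext (Category.comp_id F.φ)
  assoc F G H := Hom.ext (Category.assoc F.φ G.φ H.φ)

/-- The degree zero part of a dg-algebra is a monoid. -/
instance (M : DGAlgebra V) : MonObj (M.K.X 0) where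
  one := M.one
  mul := M.wedge 0 0 0 rfl
  one_mul := M.one_wedge 0
  mul_one := M.wedge_one 0
  mul_assoc := M.wedge_assoc 0 0 0 0 0 0 rfl rfl rfl rfl

/-- The degree zero part of a dg-algebra, as a monoid. -/
def deg0 (M : DGAlgebra V) : Mon V where
  X := M.K.X 0

/-- The degree one part of a dg-algebra, as a bimodule over the degree zero part. -/
def deg1 (M : DGAlgebra V) : Bimod M.deg0 M.deg0 where
  X := M.K.X 1
  actLeft := M.wedge 0 1 1 rfl
  one_actLeft := M.one_wedge 1
  left_assoc := M.wedge_assoc 0 0 1 0 1 1 rfl rfl rfl rfl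
  actRight := M.wedge 1 0 1 rfl
  actRight_one := M.wedge_one 1
  right_assoc := by
    have h := M.wedge_assoc 1 0 0 1 0 1 rfl rfl rfl rfl
    exact ((Iso.inv_comp_eq _).2 h).symm
  middle_assoc := M.wedge_assoc 0 1 0 1 1 1 rfl rfl rfl rfl

end DGAlgebra

/-- `tpow A n` is the tensor power `A^{⊗ (n + 1)}`, bracketed to the left. -/
def tpow (A : V) : ℕ → V
  | 0 => A
  | n + 1 => tpow A n ⊗ A

namespace DGAlgebra

/-- The morphism `pₙ : A^{⊗ (n + 1)} ⟶ Mⁿ`, `a₀ ⊗ a₁ ⊗ ⋯ ⊗ aₙ ↦ a₀ da₁ ∧ ⋯ ∧ daₙ`,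
where `A = M⁰`. -/
def p (M : DGAlgebra V) : (n : ℕ) → (tpow (M.K.X 0) n ⟶ M.K.X n)
  | 0 => 𝟙 (M.K.X 0)
  | n + 1 => (p M n ⊗ₘ M.K.d 0 1) ≫ M.wedge n 1 (n + 1) rfl

/-- The morphism `A^{⊗ (n + 1)} ⟶ Mⁿ⁺¹`, `a₀ ⊗ a₁ ⊗ ⋯ ⊗ aₙ ↦ da₀ ∧ da₁ ∧ ⋯ ∧ daₙ`,
where `A = M⁰`. -/
def dpow (M : DGAlgebra V) : (n : ℕ) → (tpow (M.K.X 0) n ⟶ M.K.X (n + 1))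
  | 0 => M.K.d 0 1
  | n + 1 => (dpow M n ⊗ₘ M.K.d 0 1) ≫ M.wedge (n + 1) 1 (n + 2) rfl

end DGAlgebra

/-! ### Differential calculi -/

variable (V) in
/-- A dg-algebra is a differential calculus (over its degree zero part) if it is generated by
its degree zero part, in the sense that all the morphisms `pₙ` are epimorphisms of `V`. -/
def IsDifferentialCalculus : ObjectProperty (DGAlgebra V) :=
  fun M => ∀ n : ℕ, Epi (M.p n)

variable (V) in
/-- The category `Calc^•(V)` of differential calculi, as a full subcategory of the category of
monoids in cochain complexes. -/
abbrev Calc := (IsDifferentialCalculus V).FullSubcategory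

variable (V) in
/-- The truncation `π : Calc^•(V) ⥤ Calc¹(V)`, `Ω^• ↦ (Ω⁰, Ω¹)`. -/
def truncation : Calc V ⥤ Calc1 V where
  obj M :=
    { A := M.obj.deg0
      Ω := M.obj.deg1
      d := M.obj.K.d 0 1
      leibniz := by
        have h := M.obj.leibniz 0 0 0 rfl
        rw [pow_zero, one_smul] at h
        exact h
      surjective := by
        have h := M.property 1
        have e : M.obj.p 1 = M.obj.K.X 0 ◁ M.obj.K.d 0 1 ≫ M.obj.wedge 0 1 1 rfl := by
          simp only [DGAlgebra.p]
          exact congrArg (· ≫ M.obj.wedge 0 1 1 rfl) (id_tensorHom (M.obj.K.X 0) (M.obj.K.d 0 1))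
        rw [e] at h
        exact h }
  map {M N} F :=
    { f := Mon.Hom.mk' (F.hom.φ.f 0) F.hom.one_comm (F.hom.wedge_comm 0 0 0 rfl)
      g := F.hom.φ.f 1
      actLeft_comm := F.hom.wedge_comm 0 1 1 rfl
      actRight_comm := F.hom.wedge_comm 1 0 1 rfl
      d_comm := (F.hom.φ.comm 0 1).symm }
  map_id _ := rfl
  map_comp _ _ := rfl

end DG

/-! ### The trivial extension -/

section TrivialExtension

lemma isZero_terminal {V : Type u} [Category.{v} V] [Preadditive V] [HasFiniteLimits V] :
    IsZero (⊤_ V) := terminalIsTerminal.isZero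

variable {V : Type u} [Category.{v} V] [MonoidalCategory V] [Preadditive V] [HasFiniteLimits V]

namespace Calc1

/-- The objects `A`, `Ω`, `0`, `0`, … of the trivial extension. -/
noncomputable def trivX (X : Calc1 V) : ℕ → V
  | 0 => X.A.X
  | 1 => X.Ω.X
  | _ + 2 => ⊤_ V

/-- The differentials of the trivial extension: `d⁰ = d`, all others vanish. -/
noncomputable def trivD (X : Calc1 V) : (i j : ℕ) → (X.trivX i ⟶ X.trivX j)
  | 0, 1 => X.d
  | _, _ => 0

/-- The cochain complex `A ⟶ Ω ⟶ 0 ⟶ ⋯`. -/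
noncomputable def trivK (X : Calc1 V) : CochainComplex V ℕ where
  X := X.trivX
  d := X.trivD
  shape i j h := by
    match i, j, h with
    | 0, 0, _ => rfl
    | 0, 1, h => exact absurd rfl h
    | 0, _ + 2, _ => rfl
    | _ + 1, _, _ => rfl
  d_comp_d' i j k hij hjk := by
    obtain rfl : i + 1 = j := hij
    obtain rfl : i + 1 + 1 = k := hjk
    exact isZero_terminal.eq_of_tgt _ _

/-- The multiplication of the trivial extension: the multiplication of `A`, the two actions of `A`
on `Ω`, and zero otherwise. -/
noncomputable def trivWedge (X : Calc1 V) :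
    (i j n : ℕ) → i + j = n → (X.trivX i ⊗ X.trivX j ⟶ X.trivX n)
  | 0, 0, 0, _ => μ[X.A.X]
  | 0, 1, 1, _ => X.Ω.actLeft
  | 1, 0, 1, _ => X.Ω.actRight
  | _, _, _, _ => 0

/-- The trivial extension as a dg-algebra. -/
noncomputable def trivDG (X : Calc1 V) : DGAlgebra V where
  K := X.trivK
  one := η[X.A.X]
  wedge := X.trivWedge
  one_d := X.one_d
  one_wedge n := by
    match n with
    | 0 => exact MonObj.one_mul X.A.X
    | 1 => exact X.Ω.one_actLeft
    | _ + 2 => exact isZero_terminal.eq_of_tgt _ _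
  wedge_one n := by
    match n with
    | 0 => exact MonObj.mul_one X.A.X
    | 1 => exact X.Ω.actRight_one
    | _ + 2 => exact isZero_terminal.eq_of_tgt _ _
  wedge_assoc i j k ij jk n hij hjk h h' := by
    subst hij hjk
    match i, j, k, n, h, h' with
    | _, _, _, _ + 2, _, _ => exact isZero_terminal.eq_of_tgt _ _
    | 0, 0, 0, 0, _, _ => exact MonObj.mul_assoc X.A.X
    | 0, 0, 1, 1, _, _ => exact X.Ω.left_assoc
    | 0, 1, 0, 1, _, _ => exact X.Ω.middle_assoc
    | 1, 0, 0, 1, _, _ => exact (Iso.inv_comp_eq _).1 X.Ω.right_assoc.symm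
    | 0, 0, 0, 1, h, _ | 0, 0, _ + 1, 0, h, _ | 0, 0, _ + 2, 1, h, _ | 0, _ + 1, _, 0, h, _
    | 0, 1, _ + 1, 1, h, _ | 0, _ + 2, _, 1, h, _ | _ + 1, _, _, 0, h, _
    | 1, 0, _ + 1, 1, h, _ | 1, _ + 1, _, 1, h, _ | _ + 2, _, _, 1, h, _ => exfalso; omega
  leibniz i j n h := by
    match i, j, n, h with
    | _, _, _ + 1, _ => exact isZero_terminal.eq_of_tgt _ _
    | 0, 0, 0, _ =>
      rw [pow_zero, one_smul]
      exact X.leibniz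
    | 0, _ + 1, 0, h | _ + 1, _, 0, h => exfalso; omega

/-- The trivial extension `Ω_{d,0}^•` of a first order differential calculus `(A, Ω, d)`:
`A` in degree `0`, `Ω` in degree `1`, `d⁰ = d`, and zero in all degrees `≥ 2`. -/
noncomputable def trivialExtension (X : Calc1 V) : Calc V where
  obj := X.trivDG
  property n := by
    match n with
    | 0 => exact (inferInstance : Epi (𝟙 X.A.X))
    | 1 =>
      have e : X.trivDG.p 1 = X.A.X ◁ X.d ≫ X.Ω.actLeft := by
        simp only [DGAlgebra.p]
        exact congrArg (· ≫ X.Ω.actLeft) (id_tensorHom X.A.X X.d)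
      rw [e]
      exact X.surjective
    | _ + 2 => exact ⟨fun _ _ _ => isZero_terminal.eq_of_src _ _⟩

end Calc1

end TrivialExtension

/-! ### The maximal prolongation -/

section MaximalProlongation

variable {V : Type u} [Category.{v} V] [MonoidalCategory V] [Preadditive V]

/-- The right action of a monoid `A` on the last factor of `A^{⊗ (n + 1)}`. -/
def tpowAct (A : V) [MonObj A] : (n : ℕ) → (tpow A n ⊗ A ⟶ tpow A n)
  | 0 => μ[A]
  | n + 1 => (α_ (tpow A n) A A).hom ≫ tpow A n ◁ μ[A]

/-- The morphism `A^{⊗ (n + 1)} ⊗ A^{⊗ 2} ⟶ A^{⊗ (n + 2)}` which multiplies the two middle factors,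
i.e. the identification `A^{⊗ (n + 1)} ⊗_A A^{⊗ 2} ≅ A^{⊗ (n + 2)}`. -/
def tpowConcat (A : V) [MonObj A] (n : ℕ) : tpow A n ⊗ (A ⊗ A) ⟶ tpow A (n + 1) :=
  (α_ (tpow A n) A A).inv ≫ tpowAct A n ▷ A

/-- The dg-algebra `U` is the maximal prolongation `Ω_u^•` of the universal first order calculus
over the monoid `A = U⁰`, exhibited as such by morphisms `incₙ : Uⁿ ⟶ A^{⊗ (n + 1)}`:

* `inc₁ : U¹ ⟶ A ⊗ A` is the kernel of the multiplication of `A`, with the bimodule structure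
  induced by the outer multiplications of `A ⊗ A` (`inc_wedge` for `n = 0` is left linearity) and
  with `inc₁ ∘ d⁰ = i ⊗ 1 - 1 ⊗ i`;
* `Uⁿ` is the `n`-fold tensor power of `U¹` over `A`: the multiplication `Uⁿ ⊗ Uᵐ ⟶ Uⁿ⁺ᵐ` is the
  coequalizer which defines the tensor product of `Uⁿ` and `Uᵐ` over `A`;
* `incₙ` is the `n`-fold tensor power of `inc₁` over `A`;
* `dⁿ` is the composite of `incₙ`, of `d ⊗ ⋯ ⊗ d` and of the multiplication. -/
structure IsUniversalProlongation (U : DGAlgebra V)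
    (inc : (n : ℕ) → (U.K.X n ⟶ tpow (U.K.X 0) n)) : Prop where
  inc_zero : inc 0 = 𝟙 (U.K.X 0)
  inc_one_mul : (inc 1 : U.K.X 1 ⟶ U.K.X 0 ⊗ U.K.X 0) ≫ μ[U.K.X 0] = 0
  isKernel : Nonempty (IsLimit (KernelFork.ofι (f := μ[U.K.X 0]) (inc 1) inc_one_mul))
  inc_one_right : U.wedge 1 0 1 rfl ≫ (inc 1 : U.K.X 1 ⟶ U.K.X 0 ⊗ U.K.X 0) =
    (inc 1 : U.K.X 1 ⟶ U.K.X 0 ⊗ U.K.X 0) ▷ U.K.X 0 ≫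
      (α_ (U.K.X 0) (U.K.X 0) (U.K.X 0)).hom ≫ U.K.X 0 ◁ μ[U.K.X 0]
  d_inc_one : U.K.d 0 1 ≫ (inc 1 : U.K.X 1 ⟶ U.K.X 0 ⊗ U.K.X 0) =
    (λ_ (U.K.X 0)).inv ≫ η[U.K.X 0] ▷ U.K.X 0 - (ρ_ (U.K.X 0)).inv ≫ U.K.X 0 ◁ η[U.K.X 0]
  wedge_balanced (n m : ℕ) :
    U.wedge n 0 n rfl ▷ U.K.X m ≫ U.wedge n m (n + m) rfl =
      ((α_ (U.K.X n) (U.K.X 0) (U.K.X m)).hom ≫ U.K.X n ◁ U.wedge 0 m m (zero_add m)) ≫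
        U.wedge n m (n + m) rfl
  isCoequalizer (n m : ℕ) :
    Nonempty (IsColimit (Cofork.ofπ (U.wedge n m (n + m) rfl) (wedge_balanced n m)))
  inc_wedge (n : ℕ) : U.wedge n 1 (n + 1) rfl ≫ inc (n + 1) =
    (inc n ⊗ₘ (inc 1 : U.K.X 1 ⟶ U.K.X 0 ⊗ U.K.X 0)) ≫ tpowConcat (U.K.X 0) n
  d_eq (n : ℕ) : U.K.d n (n + 1) = inc n ≫ U.dpow n

/-- A morphism of dg-algebras `F : U ⟶ M` exhibits `Mⁿ` (for `n = k + 2`) as the colimit of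

`⨁_{i + j = n, i, j ≥ 1} Mⁱ ⊗ Mʲ ⟵ ⨁_{i + j = n, i, j ≥ 1} Uⁱ ⊗ Uʲ ⟶ Uⁿ ⟵ Uⁿ⁻¹ ⟶ Mⁿ⁻¹`

with coprojections the multiplications `Mⁱ ⊗ Mʲ ⟶ Mⁿ`, the morphism `Fⁿ : Uⁿ ⟶ Mⁿ` and the
differential `Mⁿ⁻¹ ⟶ Mⁿ`; the finite direct sums are expressed through families of morphisms. -/
def IsProlongationStep {U M : DGAlgebra V} (F : U ⟶ M) (k : ℕ) : Prop :=
  ∀ (Z : V)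
    (a : (i j : ℕ) → 1 ≤ i → 1 ≤ j → i + j = k + 2 → (M.K.X i ⊗ M.K.X j ⟶ Z))
    (b : U.K.X (k + 2) ⟶ Z) (c : M.K.X (k + 1) ⟶ Z),
    (∀ (i j : ℕ) (hi : 1 ≤ i) (hj : 1 ≤ j) (h : i + j = k + 2),
      (F.φ.f i ⊗ₘ F.φ.f j) ≫ a i j hi hj h = U.wedge i j (k + 2) h ≫ b) →
    F.φ.f (k + 1) ≫ c = U.K.d (k + 1) (k + 2) ≫ b →
    ∃! t : M.K.X (k + 2) ⟶ Z,
      (∀ (i j : ℕ) (hi : 1 ≤ i) (hj : 1 ≤ j) (h : i + j = k + 2),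
        M.wedge i j (k + 2) h ≫ t = a i j hi hj h) ∧
      F.φ.f (k + 2) ≫ t = b ∧
      M.K.d (k + 1) (k + 2) ≫ t = c

/-- The differential calculus `M` is the maximal prolongation `Ω_{d,max}^•` of the first order
calculus `X`, via `e : X ⟶ π M`: the morphism `e` is an isomorphism, i.e. it identifies
`(M⁰, M¹, d⁰)` with `X`, and there is a morphism `F : Ω_u^• ⟶ M` from the maximal prolongation of
the universal calculus, invertible in degree `0`, such that every `Mⁿ` with `n ≥ 2` is the
colimit which defines the maximal prolongation recursively. -/
def IsMaximalProlongation {X : Calc1 V} {M : Calc V} (e : X ⟶ (truncation V).obj M) : Prop :=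
  IsIso e ∧
    ∃ (U : DGAlgebra V) (inc : (n : ℕ) → (U.K.X n ⟶ tpow (U.K.X 0) n)) (F : U ⟶ M.obj),
      IsUniversalProlongation U inc ∧ IsIso (F.φ.f 0) ∧ ∀ k : ℕ, IsProlongationStep F k

end MaximalProlongation

end NCCalc

/-! Everything is reduced to one operation, `mulD`: x ⊗ b ↦ x ∧ db. In a differential calculus `mulD
n` is an epimorphism, so a morphism out of a calculus is determined by its degree zero component
(`DGAlgebra.Hom.ext_zero`). Conversely, a family of components that is a monoid morphism in degree
zero and commutes with `mulD` is a morphism of dg-algebras (`DGAlgebra.homOfMulD`), because d and ∧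
can be computed from `mulD`.

Right adjoint: above degree one the trivial extension vanishes, so a morphism of first order calculi
already contains all components of the required dg-morphism, and it is unique by its degree zero
part.

Left adjoint, universal case: the tensor powers A^{⊗ (n + 1)} with the alternating sum of insertions
of 1 form the Amitsur dg-algebra, in which x ∧ db = x ⊗ b - xb ⊗ 1. Thus `mulD` is the identity up
to tensors ending in 1, which the next `mulD` kills since d1 = 0. This is abstracted as a
`Decomposition`. It yields idempotents a₀ ⊗ ⋯ ⊗ aₙ ↦ a₀ da₁ ∧ ⋯ ∧ daₙ, whose images form a
dg-subalgebra, the universal prolongation U. There the decomposition becomes a genuine section of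
`mulD`. This section gives both the description of Uⁿ⁺ᵐ as a tensor product over A
(`Decomposition.isColimitWedge`) and the extension of monoid morphisms to U
(`Decomposition.extend`).

Left adjoint, general case: the trivial extension serves as a dg-algebra with the prescribed degrees
zero and one. The morphism from U to it is an isomorphism in degree zero and an epimorphism in
degree one, and from degree two on the recursive colimits are formed. Their universal property
persists under U⁰ ⊗ - and - ⊗ U⁰, so the actions of U⁰ descend (`exists_prolong_left`,
`exists_prolong_right`). All projections are epimorphisms, so the remaining structure and its
identities descend from U. A morphism of first order calculi extends to U, and by the recursive
colimits this extension factors through the quotient (`exists_factor_prolongProj`). -/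

namespace NCCalc

/-! ### dg-algebras from sequences of objects and differentials -/

section OfSequence

variable {V : Type u} [Category.{v} V] [MonoidalCategory V] [Preadditive V]

/-- The dg-algebra on a sequence of objects and differentials. -/
def DGAlgebra.of (X : ℕ → V) (d : (n : ℕ) → (X n ⟶ X (n + 1))) (sq : ∀ n, d n ≫ d (n + 1) = 0)
    (one : 𝟙_ V ⟶ X 0) (wedge : (i j n : ℕ) → i + j = n → (X i ⊗ X j ⟶ X n))
    (one_d : one ≫ d 0 = 0)
    (one_wedge : ∀ n, one ▷ X n ≫ wedge 0 n n (zero_add n) = (λ_ (X n)).hom)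
    (wedge_one : ∀ n, X n ◁ one ≫ wedge n 0 n (add_zero n) = (ρ_ (X n)).hom)
    (wedge_assoc : ∀ (i j k ij jk n : ℕ) (hij : i + j = ij) (hjk : j + k = jk)
      (h : ij + k = n) (h' : i + jk = n),
      wedge i j ij hij ▷ X k ≫ wedge ij k n h =
        (α_ (X i) (X j) (X k)).hom ≫ X i ◁ wedge j k jk hjk ≫ wedge i jk n h')
    (leibniz : ∀ (i j n : ℕ) (h : i + j = n),
      wedge i j n h ≫ d n = d i ▷ X j ≫ wedge (i + 1) j (n + 1) (by omega) +
        (-1 : ℤ) ^ i • (X i ◁ d j ≫ wedge i (j + 1) (n + 1) (by omega))) :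
    DGAlgebra V where
  K := CochainComplex.of X d sq
  one := one
  wedge := wedge
  one_d := (congrArg (one ≫ ·) (CochainComplex.of_d X d 0)).trans one_d
  one_wedge := one_wedge
  wedge_one := wedge_one
  wedge_assoc := wedge_assoc
  leibniz i j n h := by
    simp only [CochainComplex.of_d]
    exact leibniz i j n h

end OfSequence

/-! ### The Amitsur dg-algebra of a monoid -/

section Amitsur

variable {V : Type u} [Category.{v} V] [MonoidalCategory V]

/-- The morphism `X ⟶ X ⊗ A`, `x ↦ x ⊗ 1`. -/
def insertOne (A : V) [MonObj A] (X : V) : X ⟶ X ⊗ A := (ρ_ X).inv ≫ X ◁ η[A]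

lemma insertOne_naturality (A : V) [MonObj A] {X Y : V} (f : X ⟶ Y) :
    f ≫ insertOne A Y = insertOne A X ≫ f ▷ A := by
  simp [insertOne, whisker_exchange]

lemma whiskerLeft_insertOne (A : V) [MonObj A] (X Y : V) :
    X ◁ insertOne A Y = insertOne A (X ⊗ Y) ≫ (α_ X Y A).hom := by
  simp [insertOne]

/-- The concatenation `A^{⊗ (i + 1)} ⊗ A^{⊗ (j + 1)} ⟶ A^{⊗ (i + j + 1)}`, which multiplies the last
factor of the first tensor power with the first factor of the second one. -/
def tpowMul (A : V) [MonObj A] (i : ℕ) : (j n : ℕ) → i + j = n → (tpow A i ⊗ tpow A j ⟶ tpow A n)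
  | 0, _, h => tpowAct A i ≫ eqToHom (congrArg (tpow A) h)
  | j + 1, n + 1, h => (α_ (tpow A i) (tpow A j) A).inv ≫ tpowMul A i j n (by omega) ▷ A
  | _ + 1, 0, h => absurd h (by omega)

lemma tpowMul_zero_right (A : V) [MonObj A] (i : ℕ) : tpowMul A i 0 i rfl = tpowAct A i :=
  Category.comp_id _

lemma tpowMul_succ_right (A : V) [MonObj A] (i j n : ℕ) (h : i + j = n) (h' : i + (j + 1) = n + 1) :
    tpowMul A i (j + 1) (n + 1) h' =
      (α_ (tpow A i) (tpow A j) A).inv ≫ tpowMul A i j n h ▷ A := rfl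

lemma tpowAct_assoc (A : V) [MonObj A] (i : ℕ) :
    tpowAct A i ▷ A ≫ tpowAct A i =
      (α_ (tpow A i) A A).hom ≫ tpow A i ◁ μ[A] ≫ tpowAct A i := by
  cases i with
  | zero => exact MonObj.mul_assoc A
  | succ i =>
    -- `tpow A (i + 1)` is a tensor product only after unfolding. The identity is therefore shown
    -- for an arbitrary object, where the monoidal rewriting applies, and transferred by
    -- definitional equality; most later `key` statements serve the same purpose.
    have key (X : V) : ((α_ X A A).hom ≫ X ◁ μ[A]) ▷ A ≫ (α_ X A A).hom ≫ X ◁ μ[A] =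
        (α_ (X ⊗ A) A A).hom ≫ (X ⊗ A) ◁ μ[A] ≫ (α_ X A A).hom ≫ X ◁ μ[A] := by
      have e := congrArg (fun t => (α_ X A A).hom ▷ A ≫ (α_ X (A ⊗ A) A).hom ≫ X ◁ t)
        (MonObj.mul_assoc A)
      simp only [MonoidalCategory.whiskerLeft_comp] at e
      simpa using e
    exact key (tpow A i)

lemma tpowAct_one (A : V) [MonObj A] (i : ℕ) :
    tpow A i ◁ η[A] ≫ tpowAct A i = (ρ_ (tpow A i)).hom := by
  cases i with
  | zero => exact MonObj.mul_one A
  | succ i =>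
    have key (X : V) : (X ⊗ A) ◁ η[A] ≫ (α_ X A A).hom ≫ X ◁ μ[A] = (ρ_ (X ⊗ A)).hom := by
      simp [← MonoidalCategory.whiskerLeft_comp]
    exact key (tpow A i)

lemma tpowMul_act (A : V) [MonObj A] (i j n : ℕ) (h : i + j = n) :
    tpowMul A i j n h ▷ A ≫ tpowAct A n =
      (α_ (tpow A i) (tpow A j) A).hom ≫ tpow A i ◁ tpowAct A j ≫ tpowMul A i j n h := by
  subst h
  cases j with
  | zero =>
    change tpowMul A i 0 i rfl ▷ A ≫ tpowAct A i =
      (α_ (tpow A i) A A).hom ≫ tpow A i ◁ μ[A] ≫ tpowMul A i 0 i rfl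
    rw [tpowMul_zero_right]
    exact tpowAct_assoc A i
  | succ j =>
    have key {X Y Z : V} (g : X ⊗ Y ⟶ Z) :
        ((α_ X Y A).inv ≫ g ▷ A) ▷ A ≫ (α_ Z A A).hom ≫ Z ◁ μ[A] =
          (α_ X (Y ⊗ A) A).hom ≫ X ◁ ((α_ Y A A).hom ≫ Y ◁ μ[A]) ≫ (α_ X Y A).inv ≫ g ▷ A := by
      rw [← cancel_epi ((α_ X Y A).hom ▷ A)]
      simp only [comp_whiskerRight, Category.assoc, hom_inv_whiskerRight_assoc]
      rw [associator_naturality_left_assoc, ← whisker_exchange]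
      simp
    exact key (tpowMul A i j (i + j) rfl)

/-- The recursion only appends factors on the right, so induction on the third degree strips them
off and leaves `tpowMul_act`. -/
lemma tpowMul_assoc (A : V) [MonObj A] (i j k ij jk n : ℕ) (hij : i + j = ij) (hjk : j + k = jk)
    (h : ij + k = n) (h' : i + jk = n) :
    tpowMul A i j ij hij ▷ tpow A k ≫ tpowMul A ij k n h =
      (α_ (tpow A i) (tpow A j) (tpow A k)).hom ≫ tpow A i ◁ tpowMul A j k jk hjk ≫
        tpowMul A i jk n h' := by
  induction k generalizing jk n with
  | zero =>
    obtain rfl : j = jk := hjk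
    obtain rfl : ij = n := h
    rw [tpowMul_zero_right, tpowMul_zero_right]
    exact tpowMul_act A i j ij hij
  | succ k ih =>
    obtain ⟨n, rfl⟩ : ∃ m, n = m + 1 := ⟨ij + k, by omega⟩
    obtain ⟨jk, rfl⟩ : ∃ m, jk = m + 1 := ⟨j + k, by omega⟩
    have key {X Y Z P Q R : V} (f : X ⊗ Y ⟶ P) (g : P ⊗ Z ⟶ Q) (f' : Y ⊗ Z ⟶ R) (g' : X ⊗ R ⟶ Q)
        (e : f ▷ Z ≫ g = (α_ X Y Z).hom ≫ X ◁ f' ≫ g') :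
        f ▷ (Z ⊗ A) ≫ (α_ P Z A).inv ≫ g ▷ A =
          (α_ X Y (Z ⊗ A)).hom ≫ X ◁ ((α_ Y Z A).inv ≫ f' ▷ A) ≫ (α_ X R A).inv ≫ g' ▷ A := by
      have e' := congrArg (fun t => (α_ (X ⊗ Y) Z A).inv ≫ t ▷ A) e
      simp only [comp_whiskerRight] at e'
      simpa using e'
    exact key _ _ _ _ (ih jk n (by omega) (by omega) (by omega))

lemma tpowMul_one_left (A : V) [MonObj A] (n : ℕ) :
    η[A] ▷ tpow A n ≫ tpowMul A 0 n n (zero_add n) = (λ_ (tpow A n)).hom := by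
  induction n with
  | zero =>
    rw [tpowMul_zero_right]
    exact MonObj.one_mul A
  | succ n ih =>
    have key {X : V} (f : A ⊗ X ⟶ X) (e : η[A] ▷ X ≫ f = (λ_ X).hom) :
        η[A] ▷ (X ⊗ A) ≫ (α_ A X A).inv ≫ f ▷ A = (λ_ (X ⊗ A)).hom := by
      have e' := congrArg (fun t => (α_ _ X A).inv ≫ t ▷ A) e
      simp only [comp_whiskerRight] at e'
      simpa using e'
    exact key _ ih

variable [Preadditive V]

/-- The differential of the Amitsur complex, the alternating sum of the insertions of `1`. -/
def tpowD (A : V) [MonObj A] : (n : ℕ) → (tpow A n ⟶ tpow A (n + 1))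
  | 0 => (λ_ A).inv ≫ η[A] ▷ A - insertOne A A
  | n + 1 => HAdd.hAdd (α := tpow A n ⊗ A ⟶ (tpow A n ⊗ A) ⊗ A) (tpowD A n ▷ A)
      ((-1 : ℤ) ^ n • insertOne A (tpow A n ⊗ A))

variable [MonoidalPreadditive V]

lemma zsmul_whiskerRight {X Y : V} (n : ℤ) (f : X ⟶ Y) (Z : V) : (n • f) ▷ Z = n • f ▷ Z :=
  (tensorRight Z).map_zsmul

lemma whiskerLeft_zsmul {X Y : V} (n : ℤ) (f : X ⟶ Y) (Z : V) : Z ◁ (n • f) = n • Z ◁ f :=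
  (tensorLeft Z).map_zsmul

lemma sub_whiskerRight {X Y : V} (f g : X ⟶ Y) (Z : V) : (f - g) ▷ Z = f ▷ Z - g ▷ Z :=
  (tensorRight Z).map_sub

lemma whiskerLeft_sub {X Y : V} (f g : X ⟶ Y) (Z : V) : Z ◁ (f - g) = Z ◁ f - Z ◁ g :=
  (tensorLeft Z).map_sub

/-- By naturality, appending 1 commutes with the differential, and the two terms that append 1 after
or before it have opposite signs. What remains is the square of the previous differential, tensored
with A. -/
lemma tpowD_comp_tpowD (A : V) [MonObj A] (n : ℕ) : tpowD A n ≫ tpowD A (n + 1) = 0 := by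
  induction n with
  | zero =>
    have key : ((λ_ A).inv ≫ η[A] ▷ A - insertOne A A) ≫
        (((λ_ A).inv ≫ η[A] ▷ A - insertOne A A) ▷ A + (-1 : ℤ) ^ 0 • insertOne A (A ⊗ A)) = 0 := by
      have h : ((λ_ A).inv ≫ η[A] ▷ A) ≫ ((λ_ A).inv ≫ η[A] ▷ A) ▷ A =
          ((λ_ A).inv ≫ η[A] ▷ A) ≫ insertOne A A ▷ A := by
        rw [insertOne, Category.assoc, ← comp_whiskerRight, Category.assoc,
          ← comp_whiskerRight]
        congr 2
        rw [leftUnitor_inv_naturality_assoc, rightUnitor_inv_naturality_assoc, whisker_exchange,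
          unitors_inv_equal]
      rw [pow_zero, one_smul, Preadditive.comp_add, insertOne_naturality, sub_whiskerRight,
        Preadditive.sub_comp, Preadditive.comp_sub, h]
      abel
    exact key
  | succ n ih =>
    have key {X : V} (f : X ⟶ X ⊗ A) (g : X ⊗ A ⟶ (X ⊗ A) ⊗ A) (hg : f ≫ g = 0)
        (e : g = f ▷ A + (-1 : ℤ) ^ n • insertOne A (X ⊗ A)) :
        (f ▷ A + (-1 : ℤ) ^ n • insertOne A (X ⊗ A)) ≫
          (g ▷ A + (-1 : ℤ) ^ (n + 1) • insertOne A ((X ⊗ A) ⊗ A)) = 0 := by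
      rw [Preadditive.comp_add, Preadditive.add_comp, ← comp_whiskerRight, hg,
        Preadditive.zsmul_comp, ← insertOne_naturality, ← e, Preadditive.comp_zsmul, pow_succ]
      simp
    exact key _ _ ih rfl

/-- The summand 1 ⊗ b of db contributes x ⊗ b, the summand b ⊗ 1 contributes xb ⊗ 1. This formula is
the model for `Decomposition`. -/
lemma tpowD_zero_mul (A : V) [MonObj A] (n : ℕ) :
    tpow A n ◁ tpowD A 0 ≫ tpowMul A n 1 (n + 1) rfl =
      (𝟙 (tpow A n ⊗ A) - tpowAct A n ≫ insertOne A (tpow A n) :) := by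
  have key {X : V} (r : X ⊗ A ⟶ X) (hr : X ◁ η[A] ≫ r = (ρ_ X).hom) :
      X ◁ ((λ_ A).inv ≫ η[A] ▷ A - insertOne A A) ≫ (α_ X A A).inv ≫ r ▷ A =
        𝟙 (X ⊗ A) - r ≫ insertOne A X := by
    have e := congrArg (fun t => t ▷ A) hr
    simp only [comp_whiskerRight, whisker_assoc, Category.assoc] at e
    rw [whiskerLeft_sub, whiskerLeft_insertOne, Preadditive.sub_comp, insertOne_naturality]
    rw [← Iso.eq_inv_comp] at e
    simp [e]
  rw [tpowMul_succ_right A n 0 n rfl, tpowMul_zero_right]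
  exact key (tpowAct A n) (tpowAct_one A n)

/-- Induction on the second degree; appending 1 to the second factor commutes with the
multiplication. For j = 0, inserting 1 just before the multiplied element gives an identity term,
which cancels the one in `tpowD_zero_mul`. -/
lemma tpowMul_leibniz (A : V) [MonObj A] (i j n : ℕ) (h : i + j = n) :
    tpowMul A i j n h ≫ tpowD A n =
      tpowD A i ▷ tpow A j ≫ tpowMul A (i + 1) j (n + 1) (by omega) +
        (-1 : ℤ) ^ i • (tpow A i ◁ tpowD A j ≫ tpowMul A i (j + 1) (n + 1) (by omega)) := by
  induction j generalizing n with
  | zero =>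
    obtain rfl : i = n := h
    rw [tpowMul_zero_right, tpowMul_zero_right]
    refine Eq.trans ?_ (congrArg (fun t => tpowD A i ▷ A ≫ tpowAct A (i + 1) + (-1 : ℤ) ^ i • t)
      (tpowD_zero_mul A i).symm)
    cases i with
    | zero =>
      have key : μ[A] ≫ ((λ_ A).inv ≫ η[A] ▷ A - insertOne A A) =
          ((λ_ A).inv ≫ η[A] ▷ A - insertOne A A) ▷ A ≫ (α_ A A A).hom ≫ A ◁ μ[A] +
            (-1 : ℤ) ^ 0 • (𝟙 (A ⊗ A) - μ[A] ≫ insertOne A A) := by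
        have e1 : insertOne A A ▷ A ≫ (α_ A A A).hom ≫ A ◁ μ[A] = 𝟙 (A ⊗ A) := by
          simp [insertOne, ← MonoidalCategory.whiskerLeft_comp]
        rw [sub_whiskerRight, Preadditive.sub_comp, e1, Preadditive.comp_sub]
        simp only [comp_whiskerRight, Category.assoc, pow_zero, one_smul]
        rw [associator_naturality_left_assoc, ← whisker_exchange]
        simp
      exact key
    | succ i =>
      have key {X : V} (f : X ⟶ X ⊗ A) (ε : ℤ) :
          ((α_ X A A).hom ≫ X ◁ μ[A]) ≫ (f ▷ A + ε • insertOne A (X ⊗ A)) =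
            (f ▷ A + ε • insertOne A (X ⊗ A)) ▷ A ≫ (α_ (X ⊗ A) A A).hom ≫ (X ⊗ A) ◁ μ[A] +
              (-ε) • (𝟙 ((X ⊗ A) ⊗ A) -
                ((α_ X A A).hom ≫ X ◁ μ[A]) ≫ insertOne A (X ⊗ A)) := by
        have e1 : insertOne A (X ⊗ A) ▷ A ≫ (α_ (X ⊗ A) A A).hom ≫ (X ⊗ A) ◁ μ[A] =
            𝟙 ((X ⊗ A) ⊗ A) := by
          rw [insertOne, comp_whiskerRight, Category.assoc, associator_naturality_middle_assoc,
            ← MonoidalCategory.whiskerLeft_comp, MonObj.one_mul]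
          simp
        have e2 : ((α_ X A A).hom ≫ X ◁ μ[A]) ≫ f ▷ A =
            f ▷ A ▷ A ≫ (α_ (X ⊗ A) A A).hom ≫ (X ⊗ A) ◁ μ[A] := by
          rw [associator_naturality_left_assoc, ← whisker_exchange, Category.assoc]
        rw [Preadditive.comp_add, MonoidalPreadditive.add_whiskerRight, Preadditive.add_comp, e2,
          zsmul_whiskerRight, Preadditive.zsmul_comp, e1, Preadditive.comp_zsmul, neg_smul,
          smul_sub]
        abel
      refine (key (tpowD A i) ((-1 : ℤ) ^ i)).trans ?_
      rw [pow_succ, mul_neg_one]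
      rfl
  | succ j ih =>
    obtain ⟨n, rfl⟩ : ∃ m, n = m + 1 := ⟨i + j, by omega⟩
    have key {X Y Z X' : V} (w : X ⊗ Y ⟶ Z) (w' : X' ⊗ Y ⟶ Z ⊗ A) (f : X ⟶ X')
        (g : Y ⟶ Y ⊗ A) (k : Z ⟶ Z ⊗ A) (a b : ℤ)
        (e : w ≫ k = f ▷ Y ≫ w' + a • (X ◁ g ≫ (α_ X Y A).inv ≫ w ▷ A)) :
        ((α_ X Y A).inv ≫ w ▷ A) ≫ (k ▷ A + (a * b) • insertOne A (Z ⊗ A)) =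
          f ▷ (Y ⊗ A) ≫ (α_ X' Y A).inv ≫ w' ▷ A +
            a • (X ◁ (g ▷ A + b • insertOne A (Y ⊗ A)) ≫ (α_ X (Y ⊗ A) A).inv ≫
              ((α_ X Y A).inv ≫ w ▷ A) ▷ A) := by
      have e1 : ((α_ X Y A).inv ≫ w ▷ A) ≫ insertOne A (Z ⊗ A) =
          X ◁ insertOne A (Y ⊗ A) ≫ (α_ X (Y ⊗ A) A).inv ≫ ((α_ X Y A).inv ≫ w ▷ A) ▷ A := by
        rw [insertOne_naturality, whiskerLeft_insertOne]
        simp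
      have e2 := congrArg (fun t => (α_ X Y A).inv ≫ t ▷ A) e
      simp only [comp_whiskerRight, MonoidalPreadditive.add_whiskerRight, zsmul_whiskerRight,
        Preadditive.comp_add, Preadditive.comp_zsmul] at e2
      rw [Preadditive.comp_add, Preadditive.comp_zsmul, e1, MonoidalPreadditive.whiskerLeft_add,
        Preadditive.add_comp, smul_add, whiskerLeft_zsmul, Preadditive.zsmul_comp, smul_smul,
        ← add_assoc, Category.assoc, e2]
      simp
    have hs : (-1 : ℤ) ^ n = (-1) ^ i * (-1) ^ j := by rw [← pow_add]; congr 1; omega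
    have := key (tpowMul A i j n (by omega)) (tpowMul A (i + 1) j (n + 1) (by omega)) (tpowD A i)
      (tpowD A j) (tpowD A n) ((-1) ^ i) ((-1) ^ j) (ih n (by omega))
    rw [← hs] at this
    exact this

/-- The Amitsur dg-algebra `A ⟶ A ⊗ A ⟶ A ⊗ A ⊗ A ⟶ ⋯` of a monoid `A`. -/
def amitsur (A : V) [MonObj A] : DGAlgebra V :=
  DGAlgebra.of (tpow A) (tpowD A) (tpowD_comp_tpowD A) η[A] (tpowMul A)
    (by
      have key : η[A] ≫ ((λ_ A).inv ≫ η[A] ▷ A - insertOne A A) = 0 := by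
        rw [insertOne, Preadditive.comp_sub, leftUnitor_inv_naturality_assoc,
          rightUnitor_inv_naturality_assoc, whisker_exchange, unitors_inv_equal, sub_self]
      exact key)
    (tpowMul_one_left A)
    (fun n => by
      rw [tpowMul_zero_right]
      exact tpowAct_one A n)
    (tpowMul_assoc A) (tpowMul_leibniz A)

lemma amitsur_d (A : V) [MonObj A] (n : ℕ) : (amitsur A).K.d n (n + 1) = tpowD A n :=
  CochainComplex.of_d _ _ _

end Amitsur

/-! ### Multiplication by differentials of degree zero elements -/

section MulD

variable {V : Type u} [Category.{v} V] [MonoidalCategory V] [Preadditive V]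

namespace DGAlgebra

/-- The morphism `Nⁿ ⊗ N⁰ ⟶ Nⁿ⁺¹`, `x ⊗ b ↦ x ∧ db`. -/
def mulD (N : DGAlgebra V) (n : ℕ) : N.K.X n ⊗ N.K.X 0 ⟶ N.K.X (n + 1) :=
  N.K.X n ◁ N.K.d 0 1 ≫ N.wedge n 1 (n + 1) rfl

lemma p_succ (N : DGAlgebra V) (n : ℕ) :
    N.p (n + 1) = (N.p n ▷ N.K.X 0 ≫ N.mulD n : tpow (N.K.X 0) n ⊗ N.K.X 0 ⟶ N.K.X (n + 1)) := by
  rw [mulD, ← tensorHom_def_assoc]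
  rfl

lemma dpow_succ (N : DGAlgebra V) (n : ℕ) :
    N.dpow (n + 1) =
      (N.dpow n ▷ N.K.X 0 ≫ N.mulD (n + 1) : tpow (N.K.X 0) n ⊗ N.K.X 0 ⟶ N.K.X (n + 2)) := by
  rw [mulD, ← tensorHom_def_assoc]
  rfl

/-- Since 1 ∧ db = db, the differential in degree zero can be recovered from `mulD`. -/
lemma one_mulD (N : DGAlgebra V) :
    (λ_ (N.K.X 0)).inv ≫ N.one ▷ N.K.X 0 ≫ N.mulD 0 = N.K.d 0 1 := by
  rw [mulD, ← whisker_exchange_assoc, N.one_wedge]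
  simp

lemma wedge_mulD (N : DGAlgebra V) (i j n : ℕ) (h : i + j = n) :
    N.wedge i j n h ▷ N.K.X 0 ≫ N.mulD n =
      (α_ _ _ _).hom ≫ N.K.X i ◁ N.mulD j ≫ N.wedge i (j + 1) (n + 1) (by omega) := by
  rw [mulD, ← whisker_exchange_assoc,
    N.wedge_assoc i j 1 n (j + 1) (n + 1) h rfl rfl (by omega), mulD]
  simp

lemma whiskerLeft_mulD_wedge (N : DGAlgebra V) (i j n : ℕ) (h : i + j = n) :
    N.K.X i ◁ N.mulD j ≫ N.wedge i (j + 1) (n + 1) (by omega) =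
      (α_ _ _ _).inv ≫ N.wedge i j n h ▷ N.K.X 0 ≫ N.mulD n := by
  rw [wedge_mulD, Iso.inv_hom_id_assoc]

variable [MonoidalPreadditive V]

lemma whiskerLeft_one_mulD (N : DGAlgebra V) (n : ℕ) : N.K.X n ◁ N.one ≫ N.mulD n = 0 := by
  rw [mulD, ← MonoidalCategory.whiskerLeft_comp_assoc, N.one_d]
  simp

lemma mulD_d (N : DGAlgebra V) (n : ℕ) :
    N.mulD n ≫ N.K.d (n + 1) (n + 2) = N.K.d n (n + 1) ▷ N.K.X 0 ≫ N.mulD (n + 1) := by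
  rw [mulD, Category.assoc, N.leibniz n 1 (n + 1) rfl, Preadditive.comp_add, Preadditive.comp_zsmul,
    ← MonoidalCategory.whiskerLeft_comp_assoc, N.K.d_comp_d, whisker_exchange_assoc, mulD]
  simp

/-- In elements, (x ∧ da) b = x ∧ d(ab) - xa ∧ db by the Leibniz rule. It reduces the right action
in degree n + 1 to the one in degree n. -/
lemma mulD_wedge_zero (N : DGAlgebra V) (n : ℕ) :
    N.mulD n ▷ N.K.X 0 ≫ N.wedge (n + 1) 0 (n + 1) rfl =
      (α_ _ _ _).hom ≫ N.K.X n ◁ N.wedge 0 0 0 rfl ≫ N.mulD n -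
        N.wedge n 0 n rfl ▷ N.K.X 0 ≫ N.mulD n := by
  have h := N.leibniz 0 0 0 rfl
  rw [pow_zero, one_smul, ← sub_eq_iff_eq_add] at h
  have e1 : N.mulD n ▷ N.K.X 0 ≫ N.wedge (n + 1) 0 (n + 1) rfl =
      (α_ _ _ _).hom ≫ N.K.X n ◁ (N.K.d 0 1 ▷ N.K.X 0 ≫ N.wedge 1 0 1 rfl) ≫
        N.wedge n 1 (n + 1) rfl := by
    rw [mulD, comp_whiskerRight, Category.assoc, N.wedge_assoc n 1 0 (n + 1) 1 (n + 1) rfl rfl rfl rfl]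
    simp
  have e2 : N.wedge n 0 n rfl ▷ N.K.X 0 ≫ N.mulD n =
      (α_ _ _ _).hom ≫ N.K.X n ◁ (N.K.X 0 ◁ N.K.d 0 1 ≫ N.wedge 0 1 1 rfl) ≫
        N.wedge n 1 (n + 1) rfl := by
    rw [wedge_mulD]
    rfl
  have e3 : N.K.X n ◁ N.wedge 0 0 0 rfl ≫ N.mulD n =
      N.K.X n ◁ (N.wedge 0 0 0 rfl ≫ N.K.d 0 1) ≫ N.wedge n 1 (n + 1) rfl := by
    simp [mulD]
  rw [e1, e2, e3, ← Preadditive.comp_sub, ← Preadditive.sub_comp, ← whiskerLeft_sub, ← h]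

end DGAlgebra

end MulD

/-! ### Tensor products of epimorphisms -/

section Epi

variable {V : Type u} [Category.{v} V] [MonoidalCategory V]

lemma epi_whiskerLeft [∀ X : V, PreservesFiniteColimits (tensorLeft X)] (X : V) {Y Z : V}
    (f : Y ⟶ Z) [Epi f] : Epi (X ◁ f) :=
  inferInstanceAs (Epi ((tensorLeft X).map f))

lemma epi_whiskerRight [∀ X : V, PreservesFiniteColimits (tensorRight X)] {Y Z : V}
    (f : Y ⟶ Z) (X : V) [Epi f] : Epi (f ▷ X) :=
  inferInstanceAs (Epi ((tensorRight X).map f))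

lemma epi_tensorHom [∀ X : V, PreservesFiniteColimits (tensorLeft X)]
    [∀ X : V, PreservesFiniteColimits (tensorRight X)] {X Y X' Y' : V} (f : X ⟶ Y) (g : X' ⟶ Y')
    [Epi f] [Epi g] : Epi (f ⊗ₘ g) := by
  have := epi_whiskerRight f X'
  have := epi_whiskerLeft Y g
  rw [MonoidalCategory.tensorHom_def]
  exact epi_comp _ _

end Epi

/-! ### Morphisms out of differential calculi -/

section Hom

variable {V : Type u} [Category.{v} V] [MonoidalCategory V] [Preadditive V]

namespace DGAlgebra

variable {M N : DGAlgebra V}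

lemma Hom.mulD_comm (F : M ⟶ N) (n : ℕ) :
    M.mulD n ≫ F.φ.f (n + 1) = (F.φ.f n ⊗ₘ F.φ.f 0) ≫ N.mulD n := by
  rw [mulD, mulD, Category.assoc, F.wedge_comm, ← id_tensorHom, ← id_tensorHom,
    tensorHom_comp_tensorHom_assoc, tensorHom_comp_tensorHom_assoc, ← F.φ.comm]
  simp

variable (M) in
lemma epi_mulD (hM : IsDifferentialCalculus V M) (n : ℕ) : Epi (M.mulD n) := by
  have h := hM (n + 1)
  rw [p_succ] at h
  have : Epi (M.p n ▷ M.K.X 0 ≫ M.mulD n) := h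
  exact epi_of_epi (M.p n ▷ M.K.X 0) _

/-- In degree n + 1 a morphism is determined by its values on the x ∧ db, hence by lower degrees.
This gives uniqueness in both adjunctions. -/
lemma Hom.ext_zero (hM : ∀ n, Epi (M.mulD n)) {F G : M ⟶ N} (h : F.φ.f 0 = G.φ.f 0) : F = G := by
  refine Hom.ext (HomologicalComplex.hom_ext _ _ fun n => ?_)
  induction n with
  | zero => exact h
  | succ n ih =>
    have := hM n
    rw [← cancel_epi (M.mulD n), F.mulD_comm, G.mulD_comm, ih, h]

variable [MonoidalPreadditive V]

/-- Induction based on d(x ∧ db) = dx ∧ db, starting from db = 1 ∧ db. -/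
lemma d_comm_of_mulD_comm (hM : ∀ n, Epi (M.mulD n)) (f : (n : ℕ) → (M.K.X n ⟶ N.K.X n))
    (hone : M.one ≫ f 0 = N.one)
    (hd : ∀ n, M.mulD n ≫ f (n + 1) = (f n ⊗ₘ f 0) ≫ N.mulD n) (n : ℕ) :
    f n ≫ N.K.d n (n + 1) = M.K.d n (n + 1) ≫ f (n + 1) := by
  induction n with
  | zero =>
    rw [← one_mulD, ← one_mulD, Category.assoc, Category.assoc, hd 0, ← tensorHom_id M.one,
      tensorHom_comp_tensorHom_assoc, hone, leftUnitor_inv_naturality_assoc, ← tensorHom_def'_assoc,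
      Category.id_comp]
  | succ n ih =>
    have := hM n
    rw [← cancel_epi (M.mulD n), ← Category.assoc, ← Category.assoc, hd, mulD_d, Category.assoc,
      Category.assoc, mulD_d, hd, ← tensorHom_id, ← tensorHom_id, tensorHom_comp_tensorHom_assoc,
      tensorHom_comp_tensorHom_assoc, ih, Category.id_comp, Category.comp_id]

variable [∀ X : V, PreservesFiniteColimits (tensorLeft X)]
  [∀ X : V, PreservesFiniteColimits (tensorRight X)]

/-- Associativity turns x ∧ (y ∧ db) into (x ∧ y) ∧ db, which lowers the second degree to zero. The
right action is then treated by induction on the first degree through `mulD_wedge_zero`. -/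
lemma wedge_comm_of_mulD_comm (hM : ∀ n, Epi (M.mulD n)) (f : (n : ℕ) → (M.K.X n ⟶ N.K.X n))
    (hmul : M.wedge 0 0 0 rfl ≫ f 0 = (f 0 ⊗ₘ f 0) ≫ N.wedge 0 0 0 rfl)
    (hd : ∀ n, M.mulD n ≫ f (n + 1) = (f n ⊗ₘ f 0) ≫ N.mulD n) (i j n : ℕ) (h : i + j = n) :
    M.wedge i j n h ≫ f n = (f i ⊗ₘ f j) ≫ N.wedge i j n h := by
  induction j generalizing n with
  | zero =>
    obtain rfl : i = n := h
    induction i with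
    | zero => exact hmul
    | succ i ih =>
      have := hM i
      have := epi_whiskerRight (M.mulD i) (M.K.X 0)
      rw [← cancel_epi (M.mulD i ▷ M.K.X 0), ← Category.assoc, mulD_wedge_zero,
        Preadditive.sub_comp, Category.assoc, Category.assoc, Category.assoc, hd,
        ← tensorHom_id, ← tensorHom_id, tensorHom_comp_tensorHom_assoc,
        tensorHom_comp_tensorHom_assoc, ih, hd, Category.id_comp, ← id_tensorHom,
        tensorHom_comp_tensorHom_assoc, hmul, Category.id_comp]
      have e1 : ((f i ⊗ₘ f 0) ≫ N.mulD i ⊗ₘ f 0) = ((f i ⊗ₘ f 0) ⊗ₘ f 0) ≫ N.mulD i ▷ N.K.X 0 := by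
        rw [← tensorHom_id, tensorHom_comp_tensorHom, Category.comp_id]
      have e2 : ((f i ⊗ₘ f 0) ≫ N.wedge i 0 i rfl ⊗ₘ f 0) =
          ((f i ⊗ₘ f 0) ⊗ₘ f 0) ≫ N.wedge i 0 i rfl ▷ N.K.X 0 := by
        rw [← tensorHom_id, tensorHom_comp_tensorHom, Category.comp_id]
      have e3 : (f i ⊗ₘ (f 0 ⊗ₘ f 0) ≫ N.wedge 0 0 0 rfl) =
          (f i ⊗ₘ (f 0 ⊗ₘ f 0)) ≫ N.K.X i ◁ N.wedge 0 0 0 rfl := by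
        rw [← id_tensorHom, tensorHom_comp_tensorHom, Category.comp_id]
      simp only [e1, e2, e3, Category.assoc, mulD_wedge_zero, Preadditive.comp_sub,
        associator_naturality_assoc]
  | succ j ih =>
    obtain ⟨n, rfl⟩ : ∃ m, n = m + 1 := ⟨i + j, by omega⟩
    have := hM j
    have := epi_whiskerLeft (M.K.X i) (M.mulD j)
    have e1 : (f i ⊗ₘ (f j ⊗ₘ f 0) ≫ N.mulD j) = (f i ⊗ₘ (f j ⊗ₘ f 0)) ≫ N.K.X i ◁ N.mulD j := by
      rw [← id_tensorHom, tensorHom_comp_tensorHom, Category.comp_id]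
    rw [← cancel_epi (M.K.X i ◁ M.mulD j), ← Category.assoc,
      whiskerLeft_mulD_wedge M i j n (by omega), Category.assoc, Category.assoc, hd, ← tensorHom_id,
      tensorHom_comp_tensorHom_assoc, ih n (by omega), Category.id_comp, ← id_tensorHom,
      tensorHom_comp_tensorHom_assoc, hd, Category.id_comp, e1, Category.assoc,
      whiskerLeft_mulD_wedge N i j n (by omega), associator_inv_naturality_assoc, ← tensorHom_id,
      tensorHom_comp_tensorHom_assoc, Category.comp_id]

/-- A family of morphisms out of a differential calculus which is compatible with the operations
`x ⊗ b ↦ x ∧ db` and a morphism of monoids in degree zero is a morphism of dg-algebras. -/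
def homOfMulD (hM : ∀ n, Epi (M.mulD n)) (f : (n : ℕ) → (M.K.X n ⟶ N.K.X n))
    (hone : M.one ≫ f 0 = N.one)
    (hmul : M.wedge 0 0 0 rfl ≫ f 0 = (f 0 ⊗ₘ f 0) ≫ N.wedge 0 0 0 rfl)
    (hd : ∀ n, M.mulD n ≫ f (n + 1) = (f n ⊗ₘ f 0) ≫ N.mulD n) : M ⟶ N where
  φ := CochainComplex.ofHom f (d_comm_of_mulD_comm hM f hone hd)
  one_comm := hone
  wedge_comm := wedge_comm_of_mulD_comm hM f hmul hd

end DGAlgebra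

end Hom

/-! ### Subalgebras and quotients of dg-algebras -/

section SubQuotient

variable {V : Type u} [Category.{v} V] [MonoidalCategory V] [Preadditive V]
  [MonoidalPreadditive V]

/-- A dg-subalgebra, given by monomorphisms through which all the operations lift. -/
def DGAlgebra.ofMono (N : DGAlgebra V) (X : ℕ → V) (inc : (n : ℕ) → (X n ⟶ N.K.X n))
    [∀ n, Mono (inc n)] (one : 𝟙_ V ⟶ X 0) (d : (n : ℕ) → (X n ⟶ X (n + 1)))
    (wedge : (i j n : ℕ) → i + j = n → (X i ⊗ X j ⟶ X n)) (one_inc : one ≫ inc 0 = N.one)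
    (d_inc : ∀ n, d n ≫ inc (n + 1) = inc n ≫ N.K.d n (n + 1))
    (wedge_inc : ∀ i j n h, wedge i j n h ≫ inc n = (inc i ⊗ₘ inc j) ≫ N.wedge i j n h) :
    DGAlgebra V :=
  DGAlgebra.of X d
    (fun n => by
      rw [← cancel_mono (inc (n + 2)), Category.assoc, d_inc, reassoc_of% (d_inc n)]
      simp)
    one wedge
    (by rw [← cancel_mono (inc 1), Category.assoc, d_inc, reassoc_of% one_inc, N.one_d]; simp)
    (fun n => by
      rw [← cancel_mono (inc n), Category.assoc, wedge_inc, ← tensorHom_id,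
        tensorHom_comp_tensorHom_assoc, one_inc, Category.id_comp, tensorHom_def'_assoc,
        N.one_wedge, leftUnitor_naturality])
    (fun n => by
      rw [← cancel_mono (inc n), Category.assoc, wedge_inc, ← id_tensorHom,
        tensorHom_comp_tensorHom_assoc, one_inc, Category.id_comp, tensorHom_def_assoc,
        N.wedge_one, rightUnitor_naturality])
    (fun i j k ij jk n hij hjk h h' => by
      rw [← cancel_mono (inc n), Category.assoc, wedge_inc, ← tensorHom_id,
        tensorHom_comp_tensorHom_assoc, wedge_inc, Category.id_comp, Category.assoc, Category.assoc,
        wedge_inc, ← id_tensorHom, tensorHom_comp_tensorHom_assoc, wedge_inc, Category.id_comp]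
      have e1 : ((inc i ⊗ₘ inc j) ≫ N.wedge i j ij hij ⊗ₘ inc k) =
          ((inc i ⊗ₘ inc j) ⊗ₘ inc k) ≫ N.wedge i j ij hij ▷ N.K.X k := by
        rw [← tensorHom_id, tensorHom_comp_tensorHom, Category.comp_id]
      have e2 : (inc i ⊗ₘ (inc j ⊗ₘ inc k) ≫ N.wedge j k jk hjk) =
          (inc i ⊗ₘ inc j ⊗ₘ inc k) ≫ N.K.X i ◁ N.wedge j k jk hjk := by
        rw [← id_tensorHom, tensorHom_comp_tensorHom, Category.comp_id]
      rw [e1, e2, Category.assoc, N.wedge_assoc i j k ij jk n hij hjk h h', Category.assoc,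
        associator_naturality_assoc])
    (fun i j n h => by
      rw [← cancel_mono (inc (n + 1)), Category.assoc, d_inc, reassoc_of% (wedge_inc i j n h),
        N.leibniz, Preadditive.add_comp, Preadditive.zsmul_comp, Category.assoc, Category.assoc,
        wedge_inc, wedge_inc, Preadditive.comp_add, Preadditive.comp_zsmul]
      simp only [← tensorHom_id, ← id_tensorHom, tensorHom_comp_tensorHom_assoc, d_inc,
        Category.id_comp, Category.comp_id])

/-- A dg-quotient algebra, given by epimorphisms through which all the operations factor. -/
def DGAlgebra.ofEpi [∀ X : V, PreservesFiniteColimits (tensorLeft X)]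
    [∀ X : V, PreservesFiniteColimits (tensorRight X)]
    (N : DGAlgebra V) (X : ℕ → V) (q : (n : ℕ) → (N.K.X n ⟶ X n))
    [∀ n, Epi (q n)] (d : (n : ℕ) → (X n ⟶ X (n + 1)))
    (wedge : (i j n : ℕ) → i + j = n → (X i ⊗ X j ⟶ X n))
    (d_q : ∀ n, q n ≫ d n = N.K.d n (n + 1) ≫ q (n + 1))
    (wedge_q : ∀ i j n h, (q i ⊗ₘ q j) ≫ wedge i j n h = N.wedge i j n h ≫ q n) :
    DGAlgebra V :=
  DGAlgebra.of X d
    (fun n => by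
      rw [← cancel_epi (q n), reassoc_of% (d_q n), d_q]
      simp)
    (N.one ≫ q 0) wedge
    (by rw [Category.assoc, d_q, reassoc_of% N.one_d, zero_comp])
    (fun n => by
      have := epi_whiskerLeft (𝟙_ V) (q n)
      rw [← cancel_epi (𝟙_ V ◁ q n), ← id_tensorHom, ← tensorHom_id, tensorHom_comp_tensorHom_assoc,
        Category.id_comp, Category.comp_id, ← Category.id_comp (q n),
        ← tensorHom_comp_tensorHom_assoc, wedge_q, tensorHom_id, reassoc_of% (N.one_wedge n),
        Category.id_comp, id_tensorHom, leftUnitor_naturality])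
    (fun n => by
      have := epi_whiskerRight (q n) (𝟙_ V)
      rw [← cancel_epi (q n ▷ 𝟙_ V), ← id_tensorHom, ← tensorHom_id, tensorHom_comp_tensorHom_assoc,
        Category.id_comp, Category.comp_id, ← Category.id_comp (q n),
        ← tensorHom_comp_tensorHom_assoc, wedge_q, id_tensorHom, reassoc_of% (N.wedge_one n),
        Category.id_comp, tensorHom_id, rightUnitor_naturality])
    (fun i j k ij jk n hij hjk h h' => by
      have := epi_tensorHom (q i) (q j)
      have := epi_tensorHom (q i ⊗ₘ q j) (q k)
      rw [← cancel_epi ((q i ⊗ₘ q j) ⊗ₘ q k), ← tensorHom_id, tensorHom_comp_tensorHom_assoc,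
        wedge_q, Category.comp_id, associator_naturality_assoc, ← id_tensorHom,
        tensorHom_comp_tensorHom_assoc, wedge_q, Category.comp_id, ← Category.id_comp (q k),
        ← tensorHom_comp_tensorHom_assoc, wedge_q, ← Category.id_comp (q i),
        ← tensorHom_comp_tensorHom_assoc, wedge_q, tensorHom_id, id_tensorHom,
        reassoc_of% (N.wedge_assoc i j k ij jk n hij hjk h h')])
    (fun i j n h => by
      have := epi_tensorHom (q i) (q j)
      rw [← cancel_epi (q i ⊗ₘ q j), reassoc_of% (wedge_q i j n h), d_q,
        reassoc_of% (N.leibniz i j n h), Preadditive.comp_add, Preadditive.comp_zsmul,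
        Preadditive.add_comp, Preadditive.zsmul_comp, Category.assoc, Category.assoc, ← wedge_q,
        ← wedge_q]
      simp only [← tensorHom_id, ← id_tensorHom, tensorHom_comp_tensorHom_assoc, d_q,
        Category.id_comp, Category.comp_id])

end SubQuotient

/-! ### Decompositions of dg-algebras and their generated subalgebras -/

section Decomposition

variable {V : Type u} [Category.{v} V] [MonoidalCategory V] [Preadditive V]

/-- The morphism `Nⁿ ⟶ Nⁿ ⊗ N⁰`, `x ↦ x ⊗ 1`. -/
def DGAlgebra.tensorOne (N : DGAlgebra V) (n : ℕ) : N.K.X n ⟶ N.K.X n ⊗ N.K.X 0 :=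
  (ρ_ _).inv ≫ N.K.X n ◁ N.one

/-- A decomposition of a dg-algebra consists of morphisms `Nⁿ⁺¹ ⟶ Nⁿ ⊗ N⁰` which map `x ∧ db` to
`x ⊗ b - x b ⊗ 1`. -/
structure Decomposition (N : DGAlgebra V) where
  /-- the underlying morphisms -/
  c (n : ℕ) : N.K.X (n + 1) ⟶ N.K.X n ⊗ N.K.X 0
  mulD_c (n : ℕ) : N.mulD n ≫ c n = 𝟙 _ - N.wedge n 0 n rfl ≫ N.tensorOne n

namespace Decomposition

variable {N : DGAlgebra V} (D : Decomposition N)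

/-- The idempotents `a₀ ⊗ a₁ ⊗ ⋯ ⊗ aₙ ↦ a₀ da₁ ∧ ⋯ ∧ daₙ`. -/
def e : (n : ℕ) → (N.K.X n ⟶ N.K.X n)
  | 0 => 𝟙 _
  | n + 1 => D.c n ≫ e n ▷ N.K.X 0 ≫ N.mulD n

lemma e_zero : D.e 0 = 𝟙 (N.K.X 0) := rfl

lemma e_succ (n : ℕ) : D.e (n + 1) = D.c n ≫ D.e n ▷ N.K.X 0 ≫ N.mulD n := rfl

end Decomposition

variable [MonoidalPreadditive V]

lemma DGAlgebra.tensorOne_mulD {M N : DGAlgebra V} {n m : ℕ} (f : M.K.X n ⟶ N.K.X m)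
    (g : M.K.X 0 ⟶ N.K.X 0) (hg : M.one ≫ g = N.one) :
    M.tensorOne n ≫ (f ⊗ₘ g) ≫ N.mulD m = 0 := by
  rw [tensorOne, Category.assoc, MonoidalCategory.tensorHom_def', Category.assoc,
    ← MonoidalCategory.whiskerLeft_comp_assoc, hg, whisker_exchange_assoc, whiskerLeft_one_mulD,
    comp_zero, comp_zero]

namespace Decomposition

variable {N : DGAlgebra V} (D : Decomposition N)

/-- The correction term xb ⊗ 1 is killed by the final `mulD`, as d1 = 0. So `c` acts as a section of
`mulD` as long as another `mulD` follows. -/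
lemma mulD_c_mulD {M : DGAlgebra V} {n m : ℕ} (f : N.K.X n ⟶ M.K.X m)
    (g : N.K.X 0 ⟶ M.K.X 0) (hg : N.one ≫ g = M.one) :
    N.mulD n ≫ D.c n ≫ (f ⊗ₘ g) ≫ M.mulD m = (f ⊗ₘ g) ≫ M.mulD m := by
  rw [reassoc_of% (D.mulD_c n), Preadditive.sub_comp, Category.assoc, DGAlgebra.tensorOne_mulD f g hg]
  simp

lemma mulD_e (n : ℕ) : N.mulD n ≫ D.e (n + 1) = D.e n ▷ N.K.X 0 ≫ N.mulD n := by
  have := D.mulD_c_mulD (D.e n) (𝟙 (N.K.X 0)) (Category.comp_id _)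
  rwa [tensorHom_id] at this

lemma e_e (n : ℕ) : D.e n ≫ D.e n = D.e n := by
  induction n with
  | zero => exact Category.comp_id _
  | succ n ih =>
    nth_rw 1 [D.e_succ]
    rw [Category.assoc, Category.assoc, D.mulD_e, ← comp_whiskerRight_assoc, ih, D.e_succ]

/-- This and the next two lemmas make the image of `e` a dg-subalgebra, stable under d, the right
action and ∧. Each time, `e (n + 1)` is rewritten through terms e(x) ∧ db, and `mulD_d`,
`mulD_wedge_zero` or `wedge_mulD` reduces the claim to lower degree. -/
lemma e_d_e (n : ℕ) : D.e n ≫ N.K.d n (n + 1) ≫ D.e (n + 1) = D.e n ≫ N.K.d n (n + 1) := by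
  induction n with
  | zero =>
    rw [D.e_zero, Category.id_comp, Category.id_comp, ← N.one_mulD, Category.assoc,
      Category.assoc, D.mulD_e, D.e_zero, id_whiskerRight, Category.id_comp]
  | succ n ih =>
    have h : D.e (n + 1) ≫ N.K.d (n + 1) (n + 2) =
        D.c n ≫ (D.e n ≫ N.K.d n (n + 1)) ▷ N.K.X 0 ≫ N.mulD (n + 1) := by
      rw [D.e_succ, Category.assoc, Category.assoc, N.mulD_d, comp_whiskerRight_assoc]
    rw [reassoc_of% h, D.mulD_e, ← comp_whiskerRight_assoc, Category.assoc, ih, h]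

lemma e_act_e (n : ℕ) : D.e n ▷ N.K.X 0 ≫ N.wedge n 0 n rfl ≫ D.e n =
    D.e n ▷ N.K.X 0 ≫ N.wedge n 0 n rfl := by
  induction n with
  | zero => rw [D.e_zero, Category.comp_id]
  | succ n ih =>
    have h : D.e n ▷ N.K.X 0 ▷ N.K.X 0 ≫ N.mulD n ▷ N.K.X 0 ≫ N.wedge (n + 1) 0 (n + 1) rfl =
        ((α_ _ _ _).hom ≫ N.K.X n ◁ N.wedge 0 0 0 rfl) ≫ D.e n ▷ N.K.X 0 ≫ N.mulD n -
          (D.e n ▷ N.K.X 0 ≫ N.wedge n 0 n rfl) ▷ N.K.X 0 ≫ N.mulD n := by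
      rw [N.mulD_wedge_zero, Preadditive.comp_sub, comp_whiskerRight_assoc, Category.assoc,
        whisker_exchange_assoc, associator_naturality_left_assoc]
    have h' : D.e (n + 1) ▷ N.K.X 0 ≫ N.wedge (n + 1) 0 (n + 1) rfl = D.c n ▷ N.K.X 0 ≫
        D.e n ▷ N.K.X 0 ▷ N.K.X 0 ≫ N.mulD n ▷ N.K.X 0 ≫ N.wedge (n + 1) 0 (n + 1) rfl := by
      rw [D.e_succ]
      simp only [comp_whiskerRight, Category.assoc]
    have h1 : D.e n ▷ N.K.X 0 ≫ N.mulD n ≫ D.e (n + 1) = D.e n ▷ N.K.X 0 ≫ N.mulD n := by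
      rw [D.mulD_e, ← comp_whiskerRight_assoc, D.e_e]
    have h2 : ((D.e n ▷ N.K.X 0 ≫ N.wedge n 0 n rfl) ▷ N.K.X 0 ≫ N.mulD n) ≫ D.e (n + 1) =
        (D.e n ▷ N.K.X 0 ≫ N.wedge n 0 n rfl) ▷ N.K.X 0 ≫ N.mulD n := by
      rw [Category.assoc, D.mulD_e, ← comp_whiskerRight_assoc, Category.assoc, ih]
    rw [reassoc_of% h', h', reassoc_of% h, h, Preadditive.sub_comp, h2]
    simp only [Category.assoc, h1]

lemma e_wedge_e (i j n : ℕ) (h : i + j = n) :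
    (D.e i ⊗ₘ D.e j) ≫ N.wedge i j n h ≫ D.e n = (D.e i ⊗ₘ D.e j) ≫ N.wedge i j n h := by
  induction j generalizing n with
  | zero =>
    obtain rfl : i = n := h
    rw [D.e_zero, tensorHom_id]
    exact D.e_act_e i
  | succ j ih =>
    obtain ⟨n, rfl⟩ : ∃ m, n = m + 1 := ⟨i + j, by omega⟩
    have e1 : (D.e i ⊗ₘ D.e (j + 1)) ≫ N.wedge i (j + 1) (n + 1) h =
        N.K.X i ◁ D.c j ≫ (α_ _ _ _).inv ≫
          ((D.e i ⊗ₘ D.e j) ≫ N.wedge i j n (by omega)) ▷ N.K.X 0 ≫ N.mulD n := by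
      rw [comp_whiskerRight_assoc, N.wedge_mulD, D.e_succ, ← tensorHom_id (D.e i ⊗ₘ D.e j),
        associator_naturality_assoc, Iso.inv_hom_id_assoc]
      simp only [← id_tensorHom, ← tensorHom_id, tensorHom_comp_tensorHom_assoc, Category.id_comp,
        Category.comp_id]
    rw [reassoc_of% e1, D.mulD_e, ← comp_whiskerRight_assoc, Category.assoc, ih, e1]

variable [HasFiniteLimits V]

lemma exists_splitting (n : ℕ) : ∃ (X : V) (i : X ⟶ N.K.X n) (p : N.K.X n ⟶ X),
    i ≫ p = 𝟙 X ∧ p ≫ i = D.e n := by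
  have : IsIdempotentComplete V :=
    Idempotents.isIdempotentComplete_iff_hasEqualizer_of_id_and_idempotent V |>.2
      fun _ _ _ => inferInstance
  exact IsIdempotentComplete.idempotents_split _ _ (D.e_e n)

/-- The objects of the subalgebra generated by the degree zero part. -/
noncomputable def subX : ℕ → V
  -- Degree zero is N⁰ itself and not a chosen splitting of its identity, so that later
  -- identifications in degree zero hold by definition.
  | 0 => N.K.X 0
  | n + 1 => (D.exists_splitting (n + 1)).choose

/-- The inclusions of the subalgebra generated by the degree zero part. -/
noncomputable def subInc : (n : ℕ) → (D.subX n ⟶ N.K.X n)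
  | 0 => 𝟙 (N.K.X 0)
  | n + 1 => (D.exists_splitting (n + 1)).choose_spec.choose

/-- The retractions onto the subalgebra generated by the degree zero part. -/
noncomputable def subRetr : (n : ℕ) → (N.K.X n ⟶ D.subX n)
  | 0 => 𝟙 (N.K.X 0)
  | n + 1 => (D.exists_splitting (n + 1)).choose_spec.choose_spec.choose

lemma subInc_subRetr : (n : ℕ) → D.subInc n ≫ D.subRetr n = 𝟙 (D.subX n)
  | 0 => Category.comp_id _
  | n + 1 => (D.exists_splitting (n + 1)).choose_spec.choose_spec.choose_spec.1

lemma subRetr_subInc : (n : ℕ) → D.subRetr n ≫ D.subInc n = D.e n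
  | 0 => Category.comp_id _
  | n + 1 => (D.exists_splitting (n + 1)).choose_spec.choose_spec.choose_spec.2

lemma subInc_e (n : ℕ) : D.subInc n ≫ D.e n = D.subInc n := by
  rw [← subRetr_subInc, reassoc_of% (D.subInc_subRetr n)]

instance (n : ℕ) : Mono (D.subInc n) := mono_of_mono_fac (D.subInc_subRetr n)

lemma subInc_d (n : ℕ) :
    (D.subInc n ≫ N.K.d n (n + 1) ≫ D.subRetr (n + 1)) ≫ D.subInc (n + 1) =
      D.subInc n ≫ N.K.d n (n + 1) := by
  have := D.subInc n ≫= D.e_d_e n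
  rw [reassoc_of% (D.subInc_e n), reassoc_of% (D.subInc_e n), ← subRetr_subInc] at this
  simpa using this

lemma subInc_wedge (i j n : ℕ) (h : i + j = n) :
    ((D.subInc i ⊗ₘ D.subInc j) ≫ N.wedge i j n h ≫ D.subRetr n) ≫ D.subInc n =
      (D.subInc i ⊗ₘ D.subInc j) ≫ N.wedge i j n h := by
  have := (D.subInc i ⊗ₘ D.subInc j) ≫= D.e_wedge_e i j n h
  rw [tensorHom_comp_tensorHom_assoc, tensorHom_comp_tensorHom_assoc, subInc_e, subInc_e,
    ← subRetr_subInc] at this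
  simpa using this

/-- The subalgebra generated by the degree zero part. -/
noncomputable def sub : DGAlgebra V :=
  N.ofMono D.subX D.subInc N.one
    (fun n => D.subInc n ≫ N.K.d n (n + 1) ≫ D.subRetr (n + 1))
    (fun i j n h => (D.subInc i ⊗ₘ D.subInc j) ≫ N.wedge i j n h ≫ D.subRetr n)
    (Category.comp_id _) D.subInc_d D.subInc_wedge

lemma sub_d (n : ℕ) :
    D.sub.K.d n (n + 1) = D.subInc n ≫ N.K.d n (n + 1) ≫ D.subRetr (n + 1) :=
  CochainComplex.of_d D.subX (fun n => D.subInc n ≫ N.K.d n (n + 1) ≫ D.subRetr (n + 1)) n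

/-- The inclusion of the subalgebra generated by the degree zero part. -/
noncomputable def incl : D.sub ⟶ N where
  φ := CochainComplex.ofHom D.subInc (fun n =>
    (D.subInc_d n).symm.trans (congrArg (· ≫ D.subInc (n + 1)) (D.sub_d n).symm))
  one_comm := Category.comp_id _
  wedge_comm := D.subInc_wedge

/-- The retractions onto the subalgebra generated by the degree zero part. -/
noncomputable def retr (n : ℕ) : N.K.X n ⟶ D.sub.K.X n := D.subRetr n

lemma incl_retr (n : ℕ) : D.incl.φ.f n ≫ D.retr n = 𝟙 (D.sub.K.X n) := D.subInc_subRetr n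

lemma retr_incl (n : ℕ) : D.retr n ≫ D.incl.φ.f n = D.e n := D.subRetr_subInc n

lemma one_retr : N.one ≫ D.retr 0 = D.sub.one := Category.comp_id _

instance (n : ℕ) : Mono (D.incl.φ.f n) := mono_of_mono_fac (D.incl_retr n)

/-- The induced decomposition of the subalgebra generated by the degree zero part. -/
noncomputable def subDecomposition : Decomposition D.sub where
  c n := D.incl.φ.f (n + 1) ≫ D.c n ≫ (D.retr n ⊗ₘ D.retr 0)
  mulD_c n := by
    have h : N.tensorOne n ≫ (D.retr n ⊗ₘ D.retr 0) = D.retr n ≫ D.sub.tensorOne n := by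
      rw [DGAlgebra.tensorOne, DGAlgebra.tensorOne, MonoidalCategory.tensorHom_def',
        Category.assoc, ← MonoidalCategory.whiskerLeft_comp_assoc, one_retr,
        rightUnitor_inv_naturality_assoc, whisker_exchange]
    rw [reassoc_of% (D.incl.mulD_comm n), reassoc_of% (D.mulD_c n), Preadditive.sub_comp,
      Preadditive.comp_sub, Category.id_comp, tensorHom_comp_tensorHom, Category.assoc, h,
      ← reassoc_of% (D.incl.wedge_comm n 0 n rfl), reassoc_of% (D.incl_retr n), incl_retr,
      incl_retr, id_tensorHom_id]

/-- Composing `c`, the projection `e n` and `mulD` gives `e (n + 1)` by definition, and this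
idempotent is the identity on its image. -/
lemma subDecomposition_c_mulD (n : ℕ) : D.subDecomposition.c n ≫ D.sub.mulD n = 𝟙 _ := by
  rw [← cancel_mono (D.incl.φ.f (n + 1)), subDecomposition]
  simp only [Category.assoc]
  rw [D.incl.mulD_comm n, tensorHom_comp_tensorHom_assoc, retr_incl, retr_incl, e_zero, tensorHom_id, ← e_succ,
    ← retr_incl, reassoc_of% (D.incl_retr (n + 1)), Category.id_comp]

end Decomposition

end Decomposition

/-! ### Split decompositions -/

section

variable {V : Type u} [Category.{v} V] [MonoidalCategory V] [Preadditive V]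

lemma DGAlgebra.wedge_balanced (U : DGAlgebra V) (n m : ℕ) :
    U.wedge n 0 n rfl ▷ U.K.X m ≫ U.wedge n m (n + m) rfl =
      ((α_ (U.K.X n) (U.K.X 0) (U.K.X m)).hom ≫ U.K.X n ◁ U.wedge 0 m m (zero_add m)) ≫
        U.wedge n m (n + m) rfl := by
  rw [Category.assoc]
  exact U.wedge_assoc n 0 m n m (n + m) rfl (zero_add m) rfl rfl

end

namespace Decomposition

variable {V : Type u} [Category.{v} V] [MonoidalCategory V] [Preadditive V]
  {U : DGAlgebra V} (D : Decomposition U)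

/-- The morphism `Uⁿ⁺ᵐ ⟶ Uⁿ ⊗ Uᵐ`, `a₀ da₁ ⋯ daₙ₊ₘ ↦ a₀ da₁ ⋯ daₙ ⊗ daₙ₊₁ ⋯ daₙ₊ₘ`. -/
def split (n : ℕ) : (m : ℕ) → (U.K.X (n + m) ⟶ U.K.X n ⊗ U.K.X m)
  | 0 => U.tensorOne n
  | m + 1 => D.c (n + m) ≫ split n m ▷ U.K.X 0 ≫ (α_ _ _ _).hom ≫ U.K.X n ◁ U.mulD m

lemma split_wedge (hD : ∀ n, D.c n ≫ U.mulD n = 𝟙 _) (n m : ℕ) :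
    D.split n m ≫ U.wedge n m (n + m) rfl = 𝟙 _ := by
  induction m with
  | zero =>
    change ((ρ_ _).inv ≫ U.K.X n ◁ U.one) ≫ U.wedge n 0 n rfl = 𝟙 _
    rw [Category.assoc, U.wedge_one, Iso.inv_hom_id]
  | succ m ih =>
    change (D.c (n + m) ≫ D.split n m ▷ U.K.X 0 ≫ (α_ _ _ _).hom ≫ U.K.X n ◁ U.mulD m) ≫
      U.wedge n (m + 1) (n + m + 1) rfl = 𝟙 _
    rw [Category.assoc, Category.assoc, Category.assoc,
      U.whiskerLeft_mulD_wedge n m (n + m) rfl, Iso.hom_inv_id_assoc, ← comp_whiskerRight_assoc, ih,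
      id_whiskerRight, Category.id_comp, hD]

variable [MonoidalPreadditive V]

/-- The correction term from `mulD_c` ends in 1 and vanishes because d1 = 0, which leaves the
recursion of `split`. -/
lemma mulD_wedge_split (n m : ℕ) :
    U.K.X n ◁ U.mulD m ≫ U.wedge n (m + 1) (n + (m + 1)) rfl ≫ D.split n (m + 1) =
      (α_ _ _ _).inv ≫ (U.wedge n m (n + m) rfl ≫ D.split n m) ▷ U.K.X 0 ≫ (α_ _ _ _).hom ≫
        U.K.X n ◁ U.mulD m := by
  have h : U.tensorOne (n + m) ≫ D.split n m ▷ U.K.X 0 ≫ (α_ _ _ _).hom ≫ U.K.X n ◁ U.mulD m =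
      0 := by
    rw [DGAlgebra.tensorOne, Category.assoc, whisker_exchange_assoc, tensor_whiskerLeft,
      Category.assoc, Category.assoc, Iso.inv_hom_id_assoc, ← MonoidalCategory.whiskerLeft_comp,
      U.whiskerLeft_one_mulD]
    simp
  change U.K.X n ◁ U.mulD m ≫ U.wedge n (m + 1) (n + m + 1) rfl ≫ D.c (n + m) ≫
    D.split n m ▷ U.K.X 0 ≫ (α_ _ _ _).hom ≫ U.K.X n ◁ U.mulD m = _
  rw [reassoc_of% (U.whiskerLeft_mulD_wedge n m (n + m) rfl), reassoc_of% (D.mulD_c (n + m)), Preadditive.sub_comp, Category.assoc, h, comp_zero, sub_zero,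
    Category.id_comp, comp_whiskerRight_assoc]

/-- Up to balancing, `D.split n m` is a retraction of the multiplication, also after tensoring. -/
lemma wedge_split_comp (hD : ∀ n, D.c n ≫ U.mulD n = 𝟙 _) (n m : ℕ) {W Z : V}
    (k : (U.K.X n ⊗ U.K.X m) ⊗ W ⟶ Z)
    (hk : U.wedge n 0 n rfl ▷ U.K.X m ▷ W ≫ k =
      ((α_ _ _ _).hom ≫ U.K.X n ◁ U.wedge 0 m m (zero_add m)) ▷ W ≫ k) :
    (U.wedge n m (n + m) rfl ≫ D.split n m) ▷ W ≫ k = k := by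
  induction m generalizing W with
  | zero =>
    -- In degree zero the composite is x ⊗ a ↦ xa ⊗ 1, and a balanced morphism has the same value on
    -- it as on x ⊗ a.
    have h : U.wedge n 0 n rfl ≫ U.tensorOne n =
        (ρ_ _).inv ≫ (U.K.X n ⊗ U.K.X 0) ◁ U.one ≫ U.wedge n 0 n rfl ▷ U.K.X 0 := by
      rw [DGAlgebra.tensorOne, rightUnitor_inv_naturality_assoc, whisker_exchange]
    have h' : (ρ_ _).inv ≫ (U.K.X n ⊗ U.K.X 0) ◁ U.one ≫ (α_ _ _ _).hom ≫
        U.K.X n ◁ U.wedge 0 0 0 (zero_add 0) = 𝟙 _ := by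
      rw [tensor_whiskerLeft, Category.assoc, Category.assoc, Iso.inv_hom_id_assoc,
        ← MonoidalCategory.whiskerLeft_comp, U.wedge_one 0]
      simp
    change (U.wedge n 0 n rfl ≫ U.tensorOne n) ▷ W ≫ k = k
    rw [h, comp_whiskerRight_assoc, comp_whiskerRight_assoc, hk, ← comp_whiskerRight_assoc,
      ← comp_whiskerRight_assoc, Category.assoc, h', id_whiskerRight, Category.id_comp]
  | succ m ih =>
    have : IsSplitEpi (U.mulD m) := ⟨⟨⟨D.c m, hD m⟩⟩⟩
    have : IsSplitEpi (U.K.X n ◁ U.mulD m) :=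
      inferInstanceAs (IsSplitEpi ((tensorLeft (U.K.X n)).map (U.mulD m)))
    have : IsSplitEpi ((U.K.X n ◁ U.mulD m) ▷ W) :=
      inferInstanceAs (IsSplitEpi ((tensorRight W).map (U.K.X n ◁ U.mulD m)))
    have h1 : U.wedge n 0 n rfl ▷ U.K.X m ▷ U.K.X 0 ≫ (α_ _ _ _).hom ≫ U.K.X n ◁ U.mulD m =
        (α_ _ _ _).hom ≫ (U.K.X n ⊗ U.K.X 0) ◁ U.mulD m ≫
          U.wedge n 0 n rfl ▷ U.K.X (m + 1) := by
      rw [associator_naturality_left_assoc, whisker_exchange]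
    have h2 : ((α_ _ _ _).hom ≫ U.K.X n ◁ U.wedge 0 m m (zero_add m)) ▷ U.K.X 0 ≫
        (α_ _ _ _).hom ≫ U.K.X n ◁ U.mulD m =
        (α_ _ _ _).hom ≫ (U.K.X n ⊗ U.K.X 0) ◁ U.mulD m ≫
          (α_ _ _ _).hom ≫ U.K.X n ◁ U.wedge 0 (m + 1) (m + 1) (zero_add _) := by
      rw [comp_whiskerRight_assoc, associator_naturality_middle_assoc,
        ← MonoidalCategory.whiskerLeft_comp, U.wedge_mulD 0 m m]
      simp
    -- The factor b of y ∧ db is absorbed into the spectator object: the induction hypothesis is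
    -- used for `U.K.X 0 ⊗ W`. This is why the statement carries `W`.
    have key := ih ((α_ (U.K.X n ⊗ U.K.X m) (U.K.X 0) W).inv ≫
      ((α_ _ _ _).hom ≫ U.K.X n ◁ U.mulD m) ▷ W ≫ k) (by
        rw [associator_inv_naturality_left_assoc, associator_inv_naturality_left_assoc,
          ← comp_whiskerRight_assoc, ← comp_whiskerRight_assoc, h1, h2]
        simp only [comp_whiskerRight_assoc] at hk ⊢
        rw [hk])
    rw [associator_inv_naturality_left_assoc, Iso.cancel_iso_inv_left,
      ← comp_whiskerRight_assoc] at key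
    rw [← cancel_epi ((U.K.X n ◁ U.mulD m) ▷ W), ← comp_whiskerRight_assoc, D.mulD_wedge_split,
      comp_whiskerRight_assoc, key, ← comp_whiskerRight_assoc, Iso.inv_hom_id_assoc]

/-- The multiplications of a dg-algebra with a split decomposition exhibit `Uⁿ⁺ᵐ` as the tensor
product of `Uⁿ` and `Uᵐ` over `U⁰`. -/
def isColimitWedge (hD : ∀ n, D.c n ≫ U.mulD n = 𝟙 _) (n m : ℕ) :
    IsColimit (Cofork.ofπ (U.wedge n m (n + m) rfl) (U.wedge_balanced n m)) :=
  Cofork.IsColimit.mk _ (fun s => D.split n m ≫ s.π)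
    (fun s => by
      have h := D.wedge_split_comp hD n m ((ρ_ _).hom ≫ s.π) (by
        rw [rightUnitor_naturality_assoc, rightUnitor_naturality_assoc, s.condition])
      rw [rightUnitor_naturality_assoc, Iso.cancel_iso_hom_left] at h
      simpa using h)
    (fun s t ht => by
      have ht' : U.wedge n m (n + m) rfl ≫ t = s.π := ht
      rw [← ht', reassoc_of% (D.split_wedge hD n m)])

/-- The components of the extension of a morphism in degree zero. -/
def extendF (N : DGAlgebra V) (f : U.K.X 0 ⟶ N.K.X 0) : (n : ℕ) → (U.K.X n ⟶ N.K.X n)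
  | 0 => f
  | n + 1 => D.c n ≫ (extendF N f n ⊗ₘ f) ≫ N.mulD n

variable [∀ X : V, PreservesFiniteColimits (tensorLeft X)]
  [∀ X : V, PreservesFiniteColimits (tensorRight X)]

/-- A morphism of monoids in degree zero extends to a dg-algebra with a split decomposition. -/
def extend (hD : ∀ n, D.c n ≫ U.mulD n = 𝟙 _) {N : DGAlgebra V} (f : U.K.X 0 ⟶ N.K.X 0)
    (hone : U.one ≫ f = N.one)
    (hmul : U.wedge 0 0 0 rfl ≫ f = (f ⊗ₘ f) ≫ N.wedge 0 0 0 rfl) : U ⟶ N :=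
  DGAlgebra.homOfMulD (fun n => (SplitEpi.mk (D.c n) (hD n)).epi) (D.extendF N f) hone hmul
    (fun _ => D.mulD_c_mulD _ f hone)

end Decomposition

/-! ### The universal prolongation -/

section Universal

variable {V : Type u} [Category.{v} V] [MonoidalCategory V] [Preadditive V] [MonoidalPreadditive V]

lemma amitsur_mulD (A : V) [MonObj A] (n : ℕ) :
    (amitsur A).mulD n = (𝟙 (tpow A n ⊗ A) - tpowAct A n ≫ insertOne A (tpow A n) :) := by
  rw [DGAlgebra.mulD, amitsur_d]
  exact tpowD_zero_mul A n

/-- The decomposition of the Amitsur dg-algebra. -/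
def amitsurDecomposition (A : V) [MonObj A] : Decomposition (amitsur A) where
  c n := 𝟙 (tpow A (n + 1))
  mulD_c n := by
    rw [amitsur_mulD]
    refine (Category.comp_id (𝟙 (tpow A n ⊗ A) - tpowAct A n ≫ insertOne A (tpow A n))).trans ?_
    rw [← tpowMul_zero_right]
    rfl

variable [HasFiniteLimits V]

/-- The maximal prolongation of the universal first order calculus over a monoid. -/
noncomputable def universal (A : V) [MonObj A] : DGAlgebra V := (amitsurDecomposition A).sub

variable (A : V) [MonObj A]

/-- The inclusions of the components of the universal prolongation into the tensor powers. -/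
noncomputable def universalInc (n : ℕ) : (universal A).K.X n ⟶ tpow A n :=
  (amitsurDecomposition A).incl.φ.f n

/-- The decomposition of the universal prolongation. -/
noncomputable def universalDecomposition : Decomposition (universal A) :=
  (amitsurDecomposition A).subDecomposition

lemma universalDecomposition_c_mulD (n : ℕ) :
    (universalDecomposition A).c n ≫ (universal A).mulD n = 𝟙 _ :=
  (amitsurDecomposition A).subDecomposition_c_mulD n

lemma epi_universal_mulD (n : ℕ) : Epi ((universal A).mulD n) :=
  (SplitEpi.mk _ (universalDecomposition_c_mulD A n)).epi

/-- The inclusion of the universal one-forms into `A ⊗ A`. -/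
noncomputable def universalInc₁ : (universal A).K.X 1 ⟶ A ⊗ A := universalInc A 1

/-- The morphism `A ⊗ A ⟶ Ω¹`, `a ⊗ b ↦ a db`. -/
noncomputable def universalRetr₁ : A ⊗ A ⟶ (universal A).K.X 1 := (amitsurDecomposition A).retr 1

lemma universalInc₁_retr₁ : universalInc₁ A ≫ universalRetr₁ A = 𝟙 _ :=
  (amitsurDecomposition A).incl_retr 1

/-- For the Amitsur dg-algebra `c` is the identity, so the idempotent in degree one is `mulD 0`. It
is the projection of A ⊗ A onto the kernel of the multiplication along A ⊗ 1. -/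
lemma universalRetr₁_inc₁ :
    universalRetr₁ A ≫ universalInc₁ A = 𝟙 (A ⊗ A) - μ[A] ≫ insertOne A A := by
  refine ((amitsurDecomposition A).retr_incl 1).trans ?_
  rw [Decomposition.e_succ, Decomposition.e_zero, id_whiskerRight, amitsur_mulD]
  exact (Category.id_comp _).trans (Category.id_comp _)

lemma universalInc₁_mul : universalInc₁ A ≫ μ[A] = 0 := by
  have h : (𝟙 (A ⊗ A) - μ[A] ≫ insertOne A A) ≫ μ[A] = 0 := by
    simp [insertOne]
  rw [← Category.id_comp (universalInc₁ A), ← universalInc₁_retr₁, Category.assoc, Category.assoc,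
    reassoc_of% (universalRetr₁_inc₁ A), h, comp_zero]

/-- The inclusion of the universal one-forms is the kernel of the multiplication. -/
noncomputable def universalInc₁IsKernel :
    IsLimit (KernelFork.ofι (f := μ[A]) (universalInc₁ A) (universalInc₁_mul A)) :=
  KernelFork.IsLimit.ofι _ _ (fun k _ => k ≫ universalRetr₁ A)
    (fun k hk => by
      rw [Category.assoc, universalRetr₁_inc₁, Preadditive.comp_sub, reassoc_of% hk]
      simp)
    (fun k _ m hm => by
      rw [← hm, Category.assoc, universalInc₁_retr₁, Category.comp_id])

/-- The multiplication inherited by the subalgebra is that of A composed with identities, so the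
agreement is not definitional. The axioms of `IsUniversalProlongation` refer to the inherited
structure and are transported along this equality. -/
lemma universal_monObj :
    @Eq (MonObj A) (inferInstance : MonObj ((universal A).K.X 0)) ‹MonObj A› := by
  apply MonObj.ext
  change (𝟙 A ⊗ₘ 𝟙 A) ≫ tpowMul A 0 0 0 rfl ≫ 𝟙 A = μ[A]
  rw [tpowMul_zero_right, id_tensorHom_id, Category.id_comp]
  exact Category.comp_id μ[A]

lemma universalInc₁_right : (universal A).wedge 1 0 1 rfl ≫ universalInc₁ A =
    universalInc₁ A ▷ A ≫ (α_ A A A).hom ≫ A ◁ μ[A] := by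
  refine ((amitsurDecomposition A).incl.wedge_comm 1 0 1 rfl).trans ?_
  have h : (amitsur A).wedge 1 0 1 rfl = (α_ A A A).hom ≫ A ◁ μ[A] := tpowMul_zero_right A 1
  rw [h]
  exact congrArg (· ≫ (α_ A A A).hom ≫ A ◁ μ[A]) (tensorHom_id (universalInc₁ A) A)

lemma universal_d_inc₁ : (universal A).K.d 0 1 ≫ universalInc₁ A =
    (λ_ A).inv ≫ η[A] ▷ A - (ρ_ A).inv ≫ A ◁ η[A] := by
  refine ((amitsurDecomposition A).incl.φ.comm 0 1).symm.trans ?_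
  rw [amitsur_d]
  exact Category.id_comp _

lemma universalInc_wedge (n : ℕ) : (universal A).wedge n 1 (n + 1) rfl ≫ universalInc A (n + 1) =
    (universalInc A n ⊗ₘ universalInc₁ A) ≫ tpowConcat A n := by
  refine ((amitsurDecomposition A).incl.wedge_comm n 1 (n + 1) rfl).trans ?_
  have h : (amitsur A).wedge n 1 (n + 1) rfl = tpowConcat A n := by
    refine (tpowMul_succ_right A n 0 n rfl rfl).trans ?_
    rw [tpowMul_zero_right]
    rfl
  rw [h]
  rfl

/-- The morphism `A^{⊗ (n + 1)} ⟶ Ωⁿ⁺¹`, `a₀ ⊗ ⋯ ⊗ aₙ ↦ da₀ ∧ ⋯ ∧ daₙ`. -/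
noncomputable def universalDpow (n : ℕ) : tpow A n ⟶ (universal A).K.X (n + 1) :=
  (universal A).dpow n

/-- The inclusion sends x ∧ db to x ⊗ b minus a tensor ending in 1. The latter is killed by `dpow`,
since d1 = 0, and the former goes to dx ∧ db by induction. -/
lemma universal_d_eq (n : ℕ) : (universal A).K.d n (n + 1) =
    universalInc A n ≫ universalDpow A n := by
  induction n with
  | zero => exact (Category.id_comp _).symm
  | succ n ih =>
    have := epi_universal_mulD A n
    rw [← cancel_epi ((universal A).mulD n), DGAlgebra.mulD_d]
    have h : (universal A).mulD n ≫ universalInc A (n + 1) = universalInc A n ▷ A ≫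
        (𝟙 (tpow A n ⊗ A) - tpowAct A n ≫ insertOne A (tpow A n)) := by
      refine ((amitsurDecomposition A).incl.mulD_comm n).trans ?_
      rw [amitsur_mulD]
      exact congrArg (· ≫ (𝟙 (tpow A n ⊗ A) - tpowAct A n ≫ insertOne A (tpow A n)))
        (tensorHom_id (universalInc A n) A)
    have key {X Y Z W : V} (r : X ⊗ A ⟶ X) (i : Y ⟶ X) (f : X ⟶ W) (g : W ⊗ A ⟶ Z)
        (hg : W ◁ η[A] ≫ g = 0) :
        (i ▷ A ≫ (𝟙 (X ⊗ A) - r ≫ insertOne A X)) ≫ f ▷ A ≫ g = (i ≫ f) ▷ A ≫ g := by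
      have h0 : insertOne A X ≫ f ▷ A ≫ g = 0 := by
        rw [← reassoc_of% (insertOne_naturality A f), insertOne, Category.assoc, hg]
        simp
      rw [Category.assoc, Preadditive.sub_comp, Category.assoc, h0]
      simp
    have h' : universalDpow A (n + 1) = (universalDpow A n ▷ A ≫ (universal A).mulD (n + 1) :) :=
      (universal A).dpow_succ n
    rw [reassoc_of% h, h', ih]
    have := key (tpowAct A n) (universalInc A n) (universalDpow A n) ((universal A).mulD (n + 1))
      ((universal A).whiskerLeft_one_mulD (n + 1))
    exact this.symm

theorem isUniversalProlongation_universal :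
    IsUniversalProlongation (universal A) (universalInc A) := by
  have hμ : (μ[(universal A).K.X 0] : A ⊗ A ⟶ A) = μ[A] :=
    congrArg (fun i : MonObj A => @MonObj.mul V _ _ A i) (universal_monObj A)
  have hi : universalInc₁ A ≫ (μ[(universal A).K.X 0] : A ⊗ A ⟶ A) = 0 :=
    (congrArg (universalInc₁ A ≫ ·) hμ).trans (universalInc₁_mul A)
  exact
    { inc_zero := rfl
      inc_one_mul := hi
      isKernel := by
        have key (m : A ⊗ A ⟶ A) (hm : m = μ[A]) (h0 : universalInc₁ A ≫ m = 0) :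
            Nonempty (IsLimit (KernelFork.ofι (f := m) (universalInc₁ A) h0)) := by
          subst hm
          exact ⟨universalInc₁IsKernel A⟩
        exact key _ hμ hi
      inc_one_right := by
        have key (m : A ⊗ A ⟶ A) (hm : m = μ[A]) :
            (universal A).wedge 1 0 1 rfl ≫ universalInc₁ A =
              universalInc₁ A ▷ A ≫ (α_ A A A).hom ≫ A ◁ m := by
          subst hm
          exact universalInc₁_right A
        exact key _ hμ
      d_inc_one := universal_d_inc₁ A
      wedge_balanced := (universal A).wedge_balanced
      isCoequalizer := fun n m =>
        ⟨(universalDecomposition A).isColimitWedge (universalDecomposition_c_mulD A) n m⟩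
      inc_wedge := fun n => (universalInc_wedge A n).trans
        (congrArg ((universalInc A n ⊗ₘ universalInc₁ A) ≫ ·)
          (congrArg (fun i : MonObj A => @tpowConcat V _ _ A i n) (universal_monObj A).symm))
      d_eq := universal_d_eq A }

end Universal

/-! ### Gluing finitely many objects along morphisms -/

section Gluing

variable {V : Type u} [Category.{v} V] [HasFiniteColimits V]

/-- The object is a pushout of finite coproducts, so its universal property survives any functor
preserving finite colimits. The functors needed later are the identity and the tensor products with
U⁰ on either side. -/
lemma exists_gluing {J : Type} [Fintype J] [DecidableEq J] {B : V} {R S : J → V}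
    (u : (s : J) → (R s ⟶ B)) (e : (s : J) → (R s ⟶ S s)) :
    ∃ (G : V) (q : B ⟶ G) (w : (s : J) → (S s ⟶ G)), (∀ s, e s ≫ w s = u s ≫ q) ∧
      ∀ (Φ : V ⥤ V) [PreservesFiniteColimits Φ] (Z : V) (a : (s : J) → (Φ.obj (S s) ⟶ Z))
        (b : Φ.obj B ⟶ Z), (∀ s, Φ.map (e s) ≫ a s = Φ.map (u s) ≫ b) →
        ∃! t : Φ.obj G ⟶ Z, (∀ s, Φ.map (w s) ≫ t = a s) ∧ Φ.map q ≫ t = b := by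
  refine ⟨pushout (Limits.Sigma.map e) (Limits.Sigma.desc u), pushout.inr _ _,
    fun s => Limits.Sigma.ι S s ≫ pushout.inl _ _, fun s => ?_, fun Φ _ Z a b hab => ?_⟩
  · have := Limits.Sigma.ι R s ≫= pushout.condition (f := Limits.Sigma.map e)
      (g := Limits.Sigma.desc u)
    simpa using this
  · have hP := isColimitOfHasPushoutOfPreservesColimit Φ (Limits.Sigma.map e) (Limits.Sigma.desc u)
    have hR := isColimitOfHasCoproductOfPreservesColimit Φ R
    have hS := isColimitOfHasCoproductOfPreservesColimit Φ S
    have hext {t t' : Φ.obj (∐ S) ⟶ Z} (h : ∀ s, Φ.map (Limits.Sigma.ι S s) ≫ t =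
        Φ.map (Limits.Sigma.ι S s) ≫ t') : t = t' := Cofan.IsColimit.hom_ext hS _ _ h
    have hext' {t t' : Φ.obj (∐ R) ⟶ Z} (h : ∀ s, Φ.map (Limits.Sigma.ι R s) ≫ t =
        Φ.map (Limits.Sigma.ι R s) ≫ t') : t = t' := Cofan.IsColimit.hom_ext hR _ _ h
    obtain ⟨l, hl⟩ : ∃ l : Φ.obj (∐ S) ⟶ Z, ∀ s, Φ.map (Limits.Sigma.ι S s) ≫ l = a s :=
      ⟨Cofan.IsColimit.desc hS a, fun s => Cofan.IsColimit.fac hS a s⟩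
    have hlb : Φ.map (Limits.Sigma.map e) ≫ l = Φ.map (Limits.Sigma.desc u) ≫ b := by
      refine hext' fun s => ?_
      rw [← Φ.map_comp_assoc, ← Φ.map_comp_assoc, Limits.Sigma.ι_map, Limits.Sigma.ι_desc,
        Φ.map_comp_assoc, hl, hab]
    obtain ⟨m, hm1, hm2⟩ : ∃ m : Φ.obj (pushout (Limits.Sigma.map e) (Limits.Sigma.desc u)) ⟶ Z,
        Φ.map (pushout.inl _ _) ≫ m = l ∧ Φ.map (pushout.inr _ _) ≫ m = b :=
      ⟨PushoutCocone.IsColimit.desc hP l b hlb, PushoutCocone.IsColimit.inl_desc hP l b hlb,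
        PushoutCocone.IsColimit.inr_desc hP l b hlb⟩
    refine ⟨m, ⟨fun s => ?_, hm2⟩, fun t ht => ?_⟩
    · dsimp only
      rw [Φ.map_comp_assoc, hm1, hl]
    · refine PushoutCocone.IsColimit.hom_ext hP (hext fun s => ?_) (ht.2.trans hm2.symm)
      have h1 := ht.1 s
      rw [Φ.map_comp_assoc] at h1
      exact h1.trans ((hl s).symm.trans (congrArg (_ ≫ ·) hm1.symm))

end Gluing

/-- Choice combined with well-founded recursion: each term is chosen subject to a relation with all
earlier terms, as for the recursive colimits. -/
lemma exists_strongRec {T : ℕ → Type*} (R : (n : ℕ) → ((i : ℕ) → i < n → T i) → T n → Prop)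
    (h : ∀ n P, ∃ t, R n P t) : ∃ Q : (n : ℕ) → T n, ∀ n, R n (fun i _ => Q i) (Q n) := by
  choose f hf using h
  refine ⟨Nat.lt_wfRel.wf.fix f, fun n => ?_⟩
  have := hf n (fun i _ => Nat.lt_wfRel.wf.fix f i)
  rw [WellFounded.fix_eq]
  exact this

/-! ### Prolongation of quotients -/

section Prolong

variable {V : Type u} [Category.{v} V]

/-- A morphism out of the object `X`, with its target. -/
structure Arrow (X : V) where
  /-- the target -/
  pt : V
  /-- the morphism -/
  π : X ⟶ pt

variable [MonoidalCategory V] [Preadditive V]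

/-- The object `G` under `Uᵏ⁺²` is obtained by gluing the objects `Pⁱ ⊗ Pʲ` for `i + j = k + 2`,
`i, j ≥ 1`, along the multiplications and the object `Pᵏ⁺¹` along the differential of `U`. The
universal property is required to persist under functors which preserve finite colimits. -/
def IsGluing (U : DGAlgebra V) (k : ℕ) (P : (i : ℕ) → i < k + 2 → Arrow (U.K.X i))
    (G : Arrow (U.K.X (k + 2))) : Prop :=
  ∃ (w : (i j : ℕ) → (hi : 1 ≤ i) → (hj : 1 ≤ j) → (h : i + j = k + 2) →
      ((P i (by omega)).pt ⊗ (P j (by omega)).pt ⟶ G.pt)) (δ : (P (k + 1) (by omega)).pt ⟶ G.pt),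
    (∀ i j hi hj h, ((P i (by omega)).π ⊗ₘ (P j (by omega)).π) ≫ w i j hi hj h =
      U.wedge i j (k + 2) h ≫ G.π) ∧
    (P (k + 1) (by omega)).π ≫ δ = U.K.d (k + 1) (k + 2) ≫ G.π ∧
    ∀ (Φ : V ⥤ V) [PreservesFiniteColimits Φ] (Z : V)
      (a : (i j : ℕ) → (hi : 1 ≤ i) → (hj : 1 ≤ j) → (h : i + j = k + 2) →
        (Φ.obj ((P i (by omega)).pt ⊗ (P j (by omega)).pt) ⟶ Z))
      (b : Φ.obj (U.K.X (k + 2)) ⟶ Z) (c : Φ.obj (P (k + 1) (by omega)).pt ⟶ Z),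
      (∀ i j hi hj h, Φ.map ((P i (by omega)).π ⊗ₘ (P j (by omega)).π) ≫ a i j hi hj h =
        Φ.map (U.wedge i j (k + 2) h) ≫ b) →
      Φ.map (P (k + 1) (by omega)).π ≫ c = Φ.map (U.K.d (k + 1) (k + 2)) ≫ b →
      ∃! t : Φ.obj G.pt ⟶ Z, (∀ i j hi hj h, Φ.map (w i j hi hj h) ≫ t = a i j hi hj h) ∧
        Φ.map G.π ≫ t = b ∧ Φ.map δ ≫ t = c

variable [HasFiniteColimits V]

lemma exists_isGluing (U : DGAlgebra V) (k : ℕ) (P : (i : ℕ) → i < k + 2 → Arrow (U.K.X i)) :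
    ∃ G, IsGluing U k P G := by
  -- `none` indexes the differential leg, `some` the product legs. The bounds in `Fin (k + 2)` lose
  -- nothing, as i, j ≥ 1 and i + j = k + 2 force i, j < k + 2.
  let J := Option {p : Fin (k + 2) × Fin (k + 2) // 1 ≤ p.1.1 ∧ 1 ≤ p.2.1 ∧ p.1.1 + p.2.1 = k + 2}
  let R : J → V := fun s => match s with
    | none => U.K.X (k + 1)
    | some p => U.K.X p.1.1.1 ⊗ U.K.X p.1.2.1
  let S : J → V := fun s => match s with
    | none => (P (k + 1) (by omega)).pt
    | some p => (P p.1.1.1 p.1.1.2).pt ⊗ (P p.1.2.1 p.1.2.2).pt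
  let u : (s : J) → (R s ⟶ U.K.X (k + 2)) := fun s => match s with
    | none => U.K.d (k + 1) (k + 2)
    | some p => U.wedge p.1.1.1 p.1.2.1 (k + 2) p.2.2.2
  let e : (s : J) → (R s ⟶ S s) := fun s => match s with
    | none => (P (k + 1) (by omega)).π
    | some p => (P p.1.1.1 p.1.1.2).π ⊗ₘ (P p.1.2.1 p.1.2.2).π
  obtain ⟨G, q, w, hw, hG⟩ := exists_gluing u e
  let idx (i j : ℕ) (hi : 1 ≤ i) (hj : 1 ≤ j) (h : i + j = k + 2) : J :=
    some ⟨(⟨i, by omega⟩, ⟨j, by omega⟩), hi, hj, h⟩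
  refine ⟨⟨G, q⟩, fun i j hi hj h => w (idx i j hi hj h), w none,
    fun i j hi hj h => hw (idx i j hi hj h), hw none, fun Φ _ Z a b c hab hcb => ?_⟩
  obtain ⟨t, ⟨h1, h2⟩, ht⟩ := hG Φ Z (fun s => match s with
    | none => c
    | some p => a p.1.1.1 p.1.2.1 p.2.1 p.2.2.1 p.2.2.2) b (fun s => match s with
    | none => hcb
    | some p => hab p.1.1.1 p.1.2.1 p.2.1 p.2.2.1 p.2.2.2)
  refine ⟨t, ⟨fun i j hi hj h => h1 (idx i j hi hj h), h2, h1 none⟩, fun t' ht' => ht t' ⟨?_, ht'.2.1⟩⟩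
  intro s
  match s with
  | none => exact ht'.2.2
  | some p => exact ht'.1 p.1.1.1 p.1.2.1 p.2.1 p.2.2.1 p.2.2.2

lemma exists_prolongation {U B : DGAlgebra V} (t : U ⟶ B) :
    ∃ Q : (n : ℕ) → Arrow (U.K.X n), Q 0 = ⟨_, t.φ.f 0⟩ ∧ Q 1 = ⟨_, t.φ.f 1⟩ ∧
      ∀ k, IsGluing U k (fun i _ => Q i) (Q (k + 2)) := by
  obtain ⟨Q, hQ⟩ := exists_strongRec (T := fun n => Arrow (U.K.X n)) (fun n => match n with
    | 0 => fun _ G => G = ⟨_, t.φ.f 0⟩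
    | 1 => fun _ G => G = ⟨_, t.φ.f 1⟩
    | k + 2 => fun P G => IsGluing U k P G) (fun n P => match n with
    | 0 => ⟨_, rfl⟩
    | 1 => ⟨_, rfl⟩
    | k + 2 => exists_isGluing U k P)
  exact ⟨Q, hQ 0, hQ 1, fun k => hQ (k + 2)⟩

/-- The recursively defined quotients of `U` which extend the components of `t` in degrees `0`
and `1`. -/
noncomputable def prolongArrow {U B : DGAlgebra V} (t : U ⟶ B) : (n : ℕ) → Arrow (U.K.X n)
  -- The chosen sequence equals these arrows only propositionally in degrees zero and one; inserting
  -- them again makes the objects there those of B by definition.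
  | 0 => ⟨_, t.φ.f 0⟩
  | 1 => ⟨_, t.φ.f 1⟩
  | n + 2 => (exists_prolongation t).choose (n + 2)

lemma isGluing_prolongArrow {U B : DGAlgebra V} (t : U ⟶ B) (k : ℕ) :
    IsGluing U k (fun i _ => prolongArrow t i) (prolongArrow t (k + 2)) := by
  obtain ⟨h0, h1, h2⟩ := (exists_prolongation t).choose_spec
  have h : prolongArrow t = (exists_prolongation t).choose := by
    funext n
    match n with
    | 0 => exact h0.symm
    | 1 => exact h1.symm
    | n + 2 => rfl
  rw [h]
  exact h2 k

end Prolong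

/-! ### The dg-algebra structure on the prolongation -/

section ProlongDG

variable {V : Type u} [Category.{v} V] [MonoidalCategory V] [Preadditive V]
  [HasFiniteColimits V] {U B : DGAlgebra V} (t : U ⟶ B)

/-- The components of the prolongation of `t`. -/
noncomputable def prolongX (n : ℕ) : V := (prolongArrow t n).pt

/-- The projections onto the components of the prolongation of `t`. -/
noncomputable def prolongQ (n : ℕ) : U.K.X n ⟶ prolongX t n := (prolongArrow t n).π

lemma prolong_spec (k : ℕ) :
    ∃ (w : (i j : ℕ) → 1 ≤ i → 1 ≤ j → i + j = k + 2 →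
        (prolongX t i ⊗ prolongX t j ⟶ prolongX t (k + 2)))
      (δ : prolongX t (k + 1) ⟶ prolongX t (k + 2)),
    (∀ i j hi hj h, (prolongQ t i ⊗ₘ prolongQ t j) ≫ w i j hi hj h =
      U.wedge i j (k + 2) h ≫ prolongQ t (k + 2)) ∧
    prolongQ t (k + 1) ≫ δ = U.K.d (k + 1) (k + 2) ≫ prolongQ t (k + 2) ∧
    ∀ (Φ : V ⥤ V) [PreservesFiniteColimits Φ] (Z : V)
      (a : (i j : ℕ) → 1 ≤ i → 1 ≤ j → i + j = k + 2 →
        (Φ.obj (prolongX t i ⊗ prolongX t j) ⟶ Z))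
      (b : Φ.obj (U.K.X (k + 2)) ⟶ Z) (c : Φ.obj (prolongX t (k + 1)) ⟶ Z),
      (∀ i j hi hj h, Φ.map (prolongQ t i ⊗ₘ prolongQ t j) ≫ a i j hi hj h =
        Φ.map (U.wedge i j (k + 2) h) ≫ b) →
      Φ.map (prolongQ t (k + 1)) ≫ c = Φ.map (U.K.d (k + 1) (k + 2)) ≫ b →
      ∃! s : Φ.obj (prolongX t (k + 2)) ⟶ Z,
        (∀ i j hi hj h, Φ.map (w i j hi hj h) ≫ s = a i j hi hj h) ∧
          Φ.map (prolongQ t (k + 2)) ≫ s = b ∧ Φ.map δ ≫ s = c :=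
  isGluing_prolongArrow t k

/-- A morphism factors through the projection of the prolongation if its restrictions do. -/
lemma exists_factor_prolongQ (k : ℕ) (Φ : V ⥤ V) [PreservesFiniteColimits Φ] {Z : V}
    (b : Φ.obj (U.K.X (k + 2)) ⟶ Z)
    (ha : ∀ i j, 1 ≤ i → 1 ≤ j → ∀ h : i + j = k + 2,
      ∃ a, Φ.map (prolongQ t i ⊗ₘ prolongQ t j) ≫ a = Φ.map (U.wedge i j (k + 2) h) ≫ b)
    (hc : ∃ c, Φ.map (prolongQ t (k + 1)) ≫ c = Φ.map (U.K.d (k + 1) (k + 2)) ≫ b) :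
    ∃ s, Φ.map (prolongQ t (k + 2)) ≫ s = b := by
  obtain ⟨_, _, _, _, h⟩ := prolong_spec t k
  choose a ha using ha
  obtain ⟨c, hc⟩ := hc
  obtain ⟨s, hs, _⟩ := h Φ Z a b c ha hc
  exact ⟨s, hs.2.1⟩

lemma exists_prolong_d (n : ℕ) :
    ∃ δ, prolongQ t n ≫ δ = U.K.d n (n + 1) ≫ prolongQ t (n + 1) := by
  match n with
  | 0 => exact ⟨B.K.d 0 1, t.φ.comm 0 1⟩
  | k + 1 =>
    obtain ⟨_, δ, _, hδ, _⟩ := prolong_spec t k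
    exact ⟨δ, hδ⟩

/-- The universal property is applied after U⁰ ⊗ -. On the product legs the action is a(x ∧ y) =
(ax) ∧ y, on the differential leg a dx = d(ax) - da ∧ x; both use the action in lower degrees only.
-/
lemma exists_prolong_left [∀ X : V, PreservesFiniteColimits (tensorLeft X)] (n : ℕ) :
    ∃ s : U.K.X 0 ⊗ prolongX t n ⟶ prolongX t n,
      U.K.X 0 ◁ prolongQ t n ≫ s = U.wedge 0 n n (zero_add n) ≫ prolongQ t n := by
  induction n using Nat.strong_induction_on with
  | _ n ih =>
    match n, ih with
    | 0, _ =>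
      refine ⟨t.φ.f 0 ▷ B.K.X 0 ≫ B.wedge 0 0 0 rfl, ?_⟩
      refine Eq.trans ?_ (t.wedge_comm 0 0 0 rfl).symm
      rw [tensorHom_def'_assoc]
      rfl
    | 1, _ =>
      refine ⟨t.φ.f 0 ▷ B.K.X 1 ≫ B.wedge 0 1 1 rfl, ?_⟩
      refine Eq.trans ?_ (t.wedge_comm 0 1 1 rfl).symm
      rw [tensorHom_def'_assoc]
      rfl
    | k + 2, ih =>
      obtain ⟨w, δ, hw, hδ, _⟩ := prolong_spec t k
      refine exists_factor_prolongQ t k (tensorLeft (U.K.X 0))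
        (U.wedge 0 (k + 2) (k + 2) (zero_add _) ≫ prolongQ t (k + 2)) ?_ ?_
      · intro i j hi hj h
        obtain ⟨s, hs⟩ := ih i (by omega)
        refine ⟨(α_ _ _ _).inv ≫ s ▷ _ ≫ w i j hi hj h, ?_⟩
        change U.K.X 0 ◁ (prolongQ t i ⊗ₘ prolongQ t j) ≫ _ = U.K.X 0 ◁ U.wedge i j (k + 2) h ≫ _
        have e := U.wedge_assoc 0 i j i (k + 2) (k + 2) (zero_add i) h h (zero_add _)
        rw [← id_tensorHom, associator_inv_naturality_assoc, ← tensorHom_id s,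
          tensorHom_comp_tensorHom_assoc, id_tensorHom, hs, Category.comp_id,
          ← Category.id_comp (prolongQ t j), ← tensorHom_comp_tensorHom_assoc, hw,
          tensorHom_id, reassoc_of% e, Iso.inv_hom_id_assoc]
      · obtain ⟨s, hs⟩ := ih (k + 1) (by omega)
        refine ⟨s ≫ δ - (U.K.d 0 1 ≫ prolongQ t 1) ▷ _ ≫
          w 1 (k + 1) le_rfl (by omega) (by omega), ?_⟩
        change U.K.X 0 ◁ prolongQ t (k + 1) ≫ _ = U.K.X 0 ◁ U.K.d (k + 1) (k + 2) ≫ _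
        have e := U.leibniz 0 (k + 1) (k + 1) (zero_add _)
        rw [pow_zero, one_smul, ← sub_eq_iff_eq_add'] at e
        rw [Preadditive.comp_sub, reassoc_of% hs, hδ, ← reassoc_of% e, Preadditive.sub_comp,
          Category.assoc, Category.assoc]
        congr 1
        rw [whisker_exchange_assoc, comp_whiskerRight_assoc, ← tensorHom_def_assoc, hw]

lemma exists_prolong_right [∀ X : V, PreservesFiniteColimits (tensorRight X)] (n : ℕ) :
    ∃ s : prolongX t n ⊗ U.K.X 0 ⟶ prolongX t n,
      prolongQ t n ▷ U.K.X 0 ≫ s = U.wedge n 0 n (add_zero n) ≫ prolongQ t n := by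
  induction n using Nat.strong_induction_on with
  | _ n ih =>
    match n, ih with
    | 0, _ =>
      refine ⟨B.K.X 0 ◁ t.φ.f 0 ≫ B.wedge 0 0 0 rfl, ?_⟩
      refine Eq.trans ?_ (t.wedge_comm 0 0 0 rfl).symm
      rw [tensorHom_def_assoc]
      rfl
    | 1, _ =>
      refine ⟨B.K.X 1 ◁ t.φ.f 0 ≫ B.wedge 1 0 1 rfl, ?_⟩
      refine Eq.trans ?_ (t.wedge_comm 1 0 1 rfl).symm
      rw [tensorHom_def_assoc]
      rfl
    | k + 2, ih =>
      obtain ⟨w, δ, hw, hδ, _⟩ := prolong_spec t k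
      refine exists_factor_prolongQ t k (tensorRight (U.K.X 0))
        (U.wedge (k + 2) 0 (k + 2) (add_zero _) ≫ prolongQ t (k + 2)) ?_ ?_
      · intro i j hi hj h
        obtain ⟨s, hs⟩ := ih j (by omega)
        refine ⟨(α_ _ _ _).hom ≫ _ ◁ s ≫ w i j hi hj h, ?_⟩
        change (prolongQ t i ⊗ₘ prolongQ t j) ▷ U.K.X 0 ≫ _ = U.wedge i j (k + 2) h ▷ U.K.X 0 ≫ _
        have e := U.wedge_assoc i j 0 (k + 2) j (k + 2) h (add_zero j) (add_zero _) h
        rw [← tensorHom_id, associator_naturality_assoc, ← id_tensorHom _ s,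
          tensorHom_comp_tensorHom_assoc, tensorHom_id, hs, Category.comp_id,
          ← Category.id_comp (prolongQ t i), ← tensorHom_comp_tensorHom_assoc, hw,
          id_tensorHom, reassoc_of% e]
      · obtain ⟨s, hs⟩ := ih (k + 1) (by omega)
        -- This is (dx) a = d(xa) - (-1)ᵏ⁺¹ x ∧ da, the Leibniz rule for x of degree k + 1.
        refine ⟨s ≫ δ - (-1 : ℤ) ^ (k + 1) • (_ ◁ (U.K.d 0 1 ≫ prolongQ t 1) ≫
          w (k + 1) 1 (by omega) le_rfl (by omega)), ?_⟩
        change prolongQ t (k + 1) ▷ U.K.X 0 ≫ _ = U.K.d (k + 1) (k + 2) ▷ U.K.X 0 ≫ _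
        have e := U.leibniz (k + 1) 0 (k + 1) (add_zero _)
        rw [← sub_eq_iff_eq_add] at e
        rw [Preadditive.comp_sub, reassoc_of% hs, hδ, ← reassoc_of% e, Preadditive.sub_comp,
          Category.assoc, Preadditive.comp_zsmul, Preadditive.zsmul_comp, Category.assoc]
        congr 2
        rw [← whisker_exchange_assoc, MonoidalCategory.whiskerLeft_comp_assoc,
          ← tensorHom_def'_assoc, hw]

variable [∀ X : V, PreservesFiniteColimits (tensorLeft X)]
  [∀ X : V, PreservesFiniteColimits (tensorRight X)]

/-- The coprojections of the colimit are jointly epimorphic. Those from products and from the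
differential are determined by the projection, because the projections in lower degrees and their
tensor products are epimorphisms. -/
lemma epi_prolongQ (h0 : Epi (t.φ.f 0)) (h1 : Epi (t.φ.f 1)) (n : ℕ) : Epi (prolongQ t n) := by
  induction n using Nat.strong_induction_on with
  | _ n ih =>
    match n, ih with
    | 0, _ => exact h0
    | 1, _ => exact h1
    | k + 2, ih =>
      refine ⟨fun {Z} f g hfg => ?_⟩
      obtain ⟨w, δ, hw, hδ, h⟩ := prolong_spec t k
      have hw' (i j : ℕ) (hi : 1 ≤ i) (hj : 1 ≤ j) (hij : i + j = k + 2) :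
          w i j hi hj hij ≫ f = w i j hi hj hij ≫ g := by
        have := ih i (by omega)
        have := ih j (by omega)
        have := epi_tensorHom (prolongQ t i) (prolongQ t j)
        rw [← cancel_epi (prolongQ t i ⊗ₘ prolongQ t j), reassoc_of% (hw i j hi hj hij),
          reassoc_of% (hw i j hi hj hij), hfg]
      have hδ' : δ ≫ f = δ ≫ g := by
        have := ih (k + 1) (by omega)
        rw [← cancel_epi (prolongQ t (k + 1)), reassoc_of% hδ, reassoc_of% hδ, hfg]
      obtain ⟨s, _, hs⟩ := h (𝟭 V) Z (fun i j hi hj hij => w i j hi hj hij ≫ f)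
        (prolongQ t (k + 2) ≫ f) (δ ≫ f)
        (fun i j hi hj hij => by
          dsimp only [Functor.id_map, Functor.id_obj]
          rw [reassoc_of% (hw i j hi hj hij)])
        (by
          dsimp only [Functor.id_map, Functor.id_obj]
          rw [reassoc_of% hδ])
      exact (hs f ⟨fun _ _ _ _ _ => rfl, rfl, rfl⟩).trans
        (hs g ⟨fun i j hi hj hij => (hw' i j hi hj hij).symm, hfg.symm, hδ'.symm⟩).symm

/-- In positive degrees the product is a coprojection. Otherwise invertibility in degree zero turns
the actions of U⁰ into actions of the degree zero part of the prolongation. -/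
lemma exists_prolong_wedge (h0 : IsIso (t.φ.f 0)) (i j n : ℕ) (h : i + j = n) :
    ∃ w, (prolongQ t i ⊗ₘ prolongQ t j) ≫ w = U.wedge i j n h ≫ prolongQ t n := by
  have h0' : IsIso (prolongQ t 0) := h0
  match i, j, h with
  | 0, j, h =>
    obtain rfl : j = n := by omega
    obtain ⟨s, hs⟩ := exists_prolong_left t j
    refine ⟨inv (prolongQ t 0) ▷ _ ≫ s, ?_⟩
    rw [← tensorHom_id (inv _), tensorHom_comp_tensorHom_assoc, IsIso.hom_inv_id, Category.comp_id,
      id_tensorHom, hs]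
  | i + 1, 0, h =>
    obtain rfl : i + 1 = n := by omega
    obtain ⟨s, hs⟩ := exists_prolong_right t (i + 1)
    refine ⟨_ ◁ inv (prolongQ t 0) ≫ s, ?_⟩
    rw [← id_tensorHom _ (inv _), tensorHom_comp_tensorHom_assoc, IsIso.hom_inv_id,
      Category.comp_id, tensorHom_id, hs]
  | i + 1, j + 1, h =>
    obtain ⟨k, rfl⟩ : ∃ k, n = k + 2 := ⟨i + j, by omega⟩
    obtain ⟨w, _, hw, _⟩ := prolong_spec t k
    exact ⟨w _ _ (by omega) (by omega) h, hw _ _ _ _ h⟩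

/-- The prolongation of a morphism `t : U ⟶ B` of dg-algebras: the components of `B` in degrees `0`
and `1`, followed by the universal quotients of the components of `U`. -/
noncomputable def prolong (h0 : IsIso (t.φ.f 0)) (h1 : Epi (t.φ.f 1)) : DGAlgebra V :=
  have (n : ℕ) : Epi (prolongQ t n) := epi_prolongQ t inferInstance h1 n
  U.ofEpi (prolongX t) (prolongQ t) (fun n => (exists_prolong_d t n).choose)
    (fun i j n h => (exists_prolong_wedge t h0 i j n h).choose)
    (fun n => (exists_prolong_d t n).choose_spec)
    (fun i j n h => (exists_prolong_wedge t h0 i j n h).choose_spec)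

variable (h0 : IsIso (t.φ.f 0)) (h1 : Epi (t.φ.f 1))

/-- The projection onto the prolongation. -/
noncomputable def prolongProj : U ⟶ prolong t h0 h1 where
  φ := CochainComplex.ofHom (prolongQ t) (fun n =>
    (congrArg (prolongQ t n ≫ ·) (CochainComplex.of_d (prolongX t)
      (fun n => (exists_prolong_d t n).choose) n)).trans (exists_prolong_d t n).choose_spec)
  one_comm := rfl
  wedge_comm i j n h := ((exists_prolong_wedge t h0 i j n h).choose_spec).symm

lemma epi_prolongProj (n : ℕ) : Epi ((prolongProj t h0 h1).φ.f n) :=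
  epi_prolongQ t inferInstance h1 n

/-- The operations of `prolong` were obtained by choice; they coincide with the coprojections
because both are determined after composing with the epimorphic projections. -/
lemma isProlongationStep_prolongProj (k : ℕ) : IsProlongationStep (prolongProj t h0 h1) k := by
  intro Z a b c hab hcb
  obtain ⟨w, δ, hw, hδ, h⟩ := prolong_spec t k
  have hw' (i j : ℕ) (hi : 1 ≤ i) (hj : 1 ≤ j) (hij : i + j = k + 2) :
      (prolong t h0 h1).wedge i j (k + 2) hij = w i j hi hj hij := by
    have := epi_prolongProj t h0 h1 i
    have := epi_prolongProj t h0 h1 j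
    have := epi_tensorHom ((prolongProj t h0 h1).φ.f i) ((prolongProj t h0 h1).φ.f j)
    refine (cancel_epi ((prolongProj t h0 h1).φ.f i ⊗ₘ (prolongProj t h0 h1).φ.f j)).1 ?_
    exact ((prolongProj t h0 h1).wedge_comm i j (k + 2) hij).symm.trans (hw i j hi hj hij).symm
  have hδ' : (prolong t h0 h1).K.d (k + 1) (k + 2) = δ := by
    have := epi_prolongProj t h0 h1 (k + 1)
    refine (cancel_epi ((prolongProj t h0 h1).φ.f (k + 1))).1 ?_
    exact ((prolongProj t h0 h1).φ.comm (k + 1) (k + 2)).trans hδ.symm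
  obtain ⟨s, ⟨hs1, hs2, hs3⟩, hs⟩ := h (𝟭 V) Z a b c hab hcb
  refine ⟨s, ⟨fun i j hi hj hij => ?_, hs2, ?_⟩, fun s' hs' => hs s' ⟨fun i j hi hj hij => ?_,
    hs'.2.1, ?_⟩⟩
  · exact (congrArg (· ≫ s) (hw' i j hi hj hij)).trans (hs1 i j hi hj hij)
  · exact (congrArg (· ≫ s) hδ').trans hs3
  · exact (congrArg (· ≫ s') (hw' i j hi hj hij)).symm.trans (hs'.1 i j hi hj hij)
  · exact (congrArg (· ≫ s') hδ').symm.trans hs'.2.2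

end ProlongDG

/-! ### Morphisms out of quotients -/

section DifferentialCalculus

variable {V : Type u} [Category.{v} V] [MonoidalCategory V] [Preadditive V]
  [∀ X : V, PreservesFiniteColimits (tensorRight X)] {U M : DGAlgebra V}

lemma DGAlgebra.isDifferentialCalculus_of_epi (F : U ⟶ M) (hF : ∀ n, Epi (F.φ.f n))
    (hU : ∀ n, Epi (U.mulD n)) : IsDifferentialCalculus V M := by
  intro n
  induction n with
  | zero => exact inferInstanceAs (Epi (𝟙 (M.K.X 0)))
  | succ n ih =>
    have : Epi (M.mulD n) := by
      have := hU n
      have := hF (n + 1)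
      exact epi_of_epi_fac (F.mulD_comm n).symm
    have := epi_whiskerRight (M.p n) (M.K.X 0)
    rw [p_succ]
    exact epi_comp (M.p n ▷ M.K.X 0) (M.mulD n)

end DifferentialCalculus

section Desc

variable {V : Type u} [Category.{v} V] [MonoidalCategory V] [Preadditive V]
  [∀ X : V, PreservesFiniteColimits (tensorLeft X)]
  [∀ X : V, PreservesFiniteColimits (tensorRight X)] {U M N : DGAlgebra V}

/-- A morphism of dg-algebras which factors degreewise through a degreewise epimorphism factors
through it. -/
def DGAlgebra.desc (F : U ⟶ M) (hF : ∀ n, Epi (F.φ.f n)) (G : U ⟶ N)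
    (ψ : (n : ℕ) → (M.K.X n ⟶ N.K.X n)) (hψ : ∀ n, F.φ.f n ≫ ψ n = G.φ.f n) : M ⟶ N where
  φ := CochainComplex.ofHom ψ (fun n => by
    have := hF n
    rw [← cancel_epi (F.φ.f n), reassoc_of% (hψ n), reassoc_of% (F.φ.comm n (n + 1)), hψ,
      G.φ.comm])
  one_comm := (congrArg (· ≫ ψ 0) F.one_comm).symm.trans
    ((Category.assoc _ _ _).trans ((congrArg (U.one ≫ ·) (hψ 0)).trans G.one_comm))
  wedge_comm i j n h := by
    have := hF i
    have := hF j
    have := epi_tensorHom (F.φ.f i) (F.φ.f j)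
    change M.wedge i j n h ≫ ψ n = (ψ i ⊗ₘ ψ j) ≫ N.wedge i j n h
    rw [← cancel_epi (F.φ.f i ⊗ₘ F.φ.f j), ← reassoc_of% (F.wedge_comm i j n h), hψ,
      G.wedge_comm, tensorHom_comp_tensorHom_assoc, hψ, hψ]

variable [HasFiniteColimits V] {B : DGAlgebra V}

/-- From degree two on there is no further obstruction: `G` respects ∧ and d, so the factorizations
in lower degrees form a compatible cocone on the recursive colimit. -/
lemma exists_factor_prolongProj (t : U ⟶ B) (h0 : IsIso (t.φ.f 0)) (h1 : Epi (t.φ.f 1)) (G : U ⟶ N)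
    (g : B.K.X 1 ⟶ N.K.X 1) (hg : t.φ.f 1 ≫ g = G.φ.f 1) (n : ℕ) :
    ∃ ψ, (prolongProj t h0 h1).φ.f n ≫ ψ = G.φ.f n := by
  change ∃ ψ, prolongQ t n ≫ ψ = G.φ.f n
  induction n using Nat.strong_induction_on with
  | _ n ih =>
    match n, ih with
    | 0, _ => exact ⟨@inv _ _ _ _ (t.φ.f 0) h0 ≫ G.φ.f 0, IsIso.hom_inv_id_assoc (t.φ.f 0) _⟩
    | 1, _ => exact ⟨g, hg⟩
    | k + 2, ih =>
      refine exists_factor_prolongQ t k (𝟭 V) (G.φ.f (k + 2)) (fun i j hi hj h => ?_) ?_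
      · obtain ⟨x, hx⟩ := ih i (by omega)
        obtain ⟨y, hy⟩ := ih j (by omega)
        refine ⟨(x ⊗ₘ y) ≫ N.wedge i j (k + 2) h, ?_⟩
        dsimp only [Functor.id_map, Functor.id_obj]
        rw [tensorHom_comp_tensorHom_assoc, hx, hy, G.wedge_comm]
      · obtain ⟨x, hx⟩ := ih (k + 1) (by omega)
        refine ⟨x ≫ N.K.d (k + 1) (k + 2), ?_⟩
        dsimp only [Functor.id_map, Functor.id_obj]
        rw [reassoc_of% hx, G.φ.comm]

variable (t : U ⟶ B) (h0 : IsIso (t.φ.f 0)) (h1 : Epi (t.φ.f 1))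

lemma prolong_one : ((prolong t h0 h1).one : 𝟙_ V ⟶ B.K.X 0) = B.one := t.one_comm

/-- The objects in degrees zero and one are those of B by definition, but the operations come from
choice. In this and the next three lemmas they are compared after the epimorphic components of `t`.
-/
lemma prolong_d_zero : ((prolong t h0 h1).K.d 0 1 : B.K.X 0 ⟶ B.K.X 1) = B.K.d 0 1 :=
  (cancel_epi (t.φ.f 0)).1
    (((prolongProj t h0 h1).φ.comm 0 1).trans (t.φ.comm 0 1).symm)

lemma prolong_wedge_zero_zero :
    ((prolong t h0 h1).wedge 0 0 0 rfl : B.K.X 0 ⊗ B.K.X 0 ⟶ B.K.X 0) = B.wedge 0 0 0 rfl :=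
  have := epi_tensorHom (t.φ.f 0) (t.φ.f 0)
  (cancel_epi (t.φ.f 0 ⊗ₘ t.φ.f 0)).1
    (((prolongProj t h0 h1).wedge_comm 0 0 0 rfl).symm.trans (t.wedge_comm 0 0 0 rfl))

lemma prolong_wedge_zero_one :
    ((prolong t h0 h1).wedge 0 1 1 rfl : B.K.X 0 ⊗ B.K.X 1 ⟶ B.K.X 1) = B.wedge 0 1 1 rfl :=
  have := epi_tensorHom (t.φ.f 0) (t.φ.f 1)
  (cancel_epi (t.φ.f 0 ⊗ₘ t.φ.f 1)).1
    (((prolongProj t h0 h1).wedge_comm 0 1 1 rfl).symm.trans (t.wedge_comm 0 1 1 rfl))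

lemma prolong_wedge_one_zero :
    ((prolong t h0 h1).wedge 1 0 1 rfl : B.K.X 1 ⊗ B.K.X 0 ⟶ B.K.X 1) = B.wedge 1 0 1 rfl :=
  have := epi_tensorHom (t.φ.f 1) (t.φ.f 0)
  (cancel_epi (t.φ.f 1 ⊗ₘ t.φ.f 0)).1
    (((prolongProj t h0 h1).wedge_comm 1 0 1 rfl).symm.trans (t.wedge_comm 1 0 1 rfl))

end Desc

lemma comp_id_eq_id_tensorHom_comp {V : Type u} [Category.{v} V] [MonoidalCategory V]
    {X Y Z : V} {f g : X ⊗ Y ⟶ Z} (h : f = g) : f ≫ 𝟙 Z = (𝟙 X ⊗ₘ 𝟙 Y) ≫ g := by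
  simp [h]

/-! ### The maximal prolongation -/

section Maximal

variable {V : Type u} [Category.{v} V] [MonoidalCategory V] [Preadditive V] [MonoidalPreadditive V]
  [HasFiniteLimits V] [∀ X : V, PreservesFiniteColimits (tensorLeft X)]
  [∀ X : V, PreservesFiniteColimits (tensorRight X)]

/-- The extension of a morphism of monoids to the universal prolongation. -/
noncomputable def universalExtend {A : V} [MonObj A] {N : DGAlgebra V} (f : A ⟶ N.K.X 0)
    (hone : η[A] ≫ f = N.one) (hmul : μ[A] ≫ f = (f ⊗ₘ f) ≫ N.wedge 0 0 0 rfl) :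
    universal A ⟶ N :=
  (universalDecomposition A).extend (universalDecomposition_c_mulD A) f hone
    ((congrArg (· ≫ f) (congrArg (fun i : MonObj A => @MonObj.mul V _ _ A i)
      (universal_monObj A))).trans hmul)

namespace Calc1

variable (X : Calc1 V)

/-- The morphism from the universal prolongation to the trivial extension. -/
noncomputable def universalToTriv : universal X.A.X ⟶ X.trivDG :=
  universalExtend (N := X.trivDG) (𝟙 X.A.X) (Category.comp_id _)
    ((Category.comp_id _).trans ((congrArg (· ≫ μ[X.A.X]) (id_tensorHom_id _ _)).trans
      (Category.id_comp _)).symm)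

lemma isIso_universalToTriv_zero : IsIso (X.universalToTriv.φ.f 0) :=
  inferInstanceAs (IsIso (𝟙 X.A.X))

lemma mulD_universalToTriv_one :
    (universal X.A.X).mulD 0 ≫ X.universalToTriv.φ.f 1 = X.A.X ◁ X.d ≫ X.Ω.actLeft := by
  refine (X.universalToTriv.mulD_comm 0).trans ?_
  exact (congrArg (· ≫ X.A.X ◁ X.d ≫ X.Ω.actLeft) (id_tensorHom_id _ _)).trans (Category.id_comp _)

lemma epi_universalToTriv_one : Epi (X.universalToTriv.φ.f 1) := by
  have := X.surjective
  exact @epi_of_epi_fac V _ _ _ _ _ _ _ this X.mulD_universalToTriv_one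

variable [HasFiniteColimits V]

/-- The maximal prolongation. -/
noncomputable def maximal : Calc V where
  obj := prolong X.universalToTriv X.isIso_universalToTriv_zero X.epi_universalToTriv_one
  property := DGAlgebra.isDifferentialCalculus_of_epi (prolongProj _ _ _) (epi_prolongProj _ _ _)
    (epi_universal_mulD X.A.X)

/-- The morphism from the universal prolongation to the maximal prolongation. -/
noncomputable def maximalProj : universal X.A.X ⟶ X.maximal.obj :=
  prolongProj X.universalToTriv X.isIso_universalToTriv_zero X.epi_universalToTriv_one

/-- The identification of a first order calculus with the truncation of its maximal
prolongation. -/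
noncomputable def toMaximal : X ⟶ (truncation V).obj X.maximal where
  f := Mon.Hom.mk' (𝟙 X.A.X)
    ((Category.comp_id _).trans (prolong_one X.universalToTriv X.isIso_universalToTriv_zero
      X.epi_universalToTriv_one).symm)
    (comp_id_eq_id_tensorHom_comp (prolong_wedge_zero_zero X.universalToTriv
      X.isIso_universalToTriv_zero X.epi_universalToTriv_one).symm)
  g := 𝟙 X.Ω.X
  actLeft_comm := comp_id_eq_id_tensorHom_comp (prolong_wedge_zero_one X.universalToTriv
      X.isIso_universalToTriv_zero X.epi_universalToTriv_one).symm
  actRight_comm := comp_id_eq_id_tensorHom_comp (prolong_wedge_one_zero X.universalToTriv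
      X.isIso_universalToTriv_zero X.epi_universalToTriv_one).symm
  d_comm := (Category.comp_id _).trans
    ((prolong_d_zero X.universalToTriv X.isIso_universalToTriv_zero
      X.epi_universalToTriv_one).symm.trans (Category.id_comp _).symm)

/-- The inverse of `toMaximal`. -/
noncomputable def ofMaximal : (truncation V).obj X.maximal ⟶ X where
  f := Mon.Hom.mk' (𝟙 X.A.X)
    ((Category.comp_id _).trans (prolong_one X.universalToTriv X.isIso_universalToTriv_zero
      X.epi_universalToTriv_one))
    (comp_id_eq_id_tensorHom_comp (prolong_wedge_zero_zero X.universalToTriv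
      X.isIso_universalToTriv_zero X.epi_universalToTriv_one))
  g := 𝟙 X.Ω.X
  actLeft_comm := comp_id_eq_id_tensorHom_comp (prolong_wedge_zero_one X.universalToTriv
      X.isIso_universalToTriv_zero X.epi_universalToTriv_one)
  actRight_comm := comp_id_eq_id_tensorHom_comp (prolong_wedge_one_zero X.universalToTriv
      X.isIso_universalToTriv_zero X.epi_universalToTriv_one)
  d_comm := (Category.comp_id _).trans
    ((prolong_d_zero X.universalToTriv X.isIso_universalToTriv_zero
      X.epi_universalToTriv_one).trans (Category.id_comp _).symm)

lemma isIso_toMaximal : IsIso X.toMaximal :=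
  ⟨X.ofMaximal, Hom.ext (Mon.Hom.ext (Category.id_comp (𝟙 X.A.X))) (Category.id_comp (𝟙 X.Ω.X)),
    Hom.ext (Mon.Hom.ext (Category.id_comp (𝟙 X.A.X))) (Category.id_comp (𝟙 X.Ω.X))⟩

lemma isMaximalProlongation_toMaximal : IsMaximalProlongation X.toMaximal :=
  ⟨X.isIso_toMaximal, universal X.A.X, universalInc X.A.X, X.maximalProj,
    isUniversalProlongation_universal X.A.X, X.isIso_universalToTriv_zero,
    isProlongationStep_prolongProj _ _ _⟩

variable {X}

/-- The extension of a morphism of first order calculi to the universal prolongation. -/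
noncomputable def universalLift {N : Calc V} (h : X ⟶ (truncation V).obj N) :
    universal X.A.X ⟶ N.obj :=
  universalExtend h.f.hom h.f.isMonHom_hom.one_hom h.f.isMonHom_hom.mul_hom

/-- Both sides send a db to f(a) d(f(b)), and `mulD 0` is an epimorphism onto the universal
one-forms. This is the degree one condition required by `exists_factor_prolongProj`. -/
lemma universalToTriv_one_comp {N : Calc V} (h : X ⟶ (truncation V).obj N) :
    X.universalToTriv.φ.f 1 ≫ h.g = (universalLift h).φ.f 1 := by
  have := epi_universal_mulD X.A.X 0
  refine (cancel_epi ((universal X.A.X).mulD 0)).1 ?_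
  refine Eq.trans ?_ ((universalLift h).mulD_comm 0).symm
  refine (Category.assoc _ _ _).symm.trans
    ((congrArg (· ≫ h.g) X.mulD_universalToTriv_one).trans ?_)
  have key {A B C D : V} (d : A ⟶ B) (l : A ⊗ B ⟶ B) (g : B ⟶ D) (f : A ⟶ C) (d' : C ⟶ D)
      (l' : C ⊗ D ⟶ D) (h1 : l ≫ g = (f ⊗ₘ g) ≫ l') (h2 : d ≫ g = f ≫ d') :
      (A ◁ d ≫ l) ≫ g = (f ⊗ₘ f) ≫ C ◁ d' ≫ l' := by
    rw [Category.assoc, h1, ← id_tensorHom, ← id_tensorHom, tensorHom_comp_tensorHom_assoc,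
      tensorHom_comp_tensorHom_assoc, h2, Category.id_comp, Category.comp_id]
  exact key X.d X.Ω.actLeft h.g h.f.hom (N.obj.K.d 0 1) (N.obj.wedge 0 1 1 rfl) h.actLeft_comm
    h.d_comm

/-- The extension of a morphism of first order calculi to the maximal prolongation. -/
noncomputable def maximalLift {N : Calc V} (h : X ⟶ (truncation V).obj N) : X.maximal ⟶ N :=
  ObjectProperty.homMk (DGAlgebra.desc X.maximalProj (epi_prolongProj _ _ _) (universalLift h)
    (fun n => (exists_factor_prolongProj X.universalToTriv X.isIso_universalToTriv_zero
      X.epi_universalToTriv_one (universalLift h) h.g (universalToTriv_one_comp h) n).choose)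
    (fun n => (exists_factor_prolongProj X.universalToTriv X.isIso_universalToTriv_zero
      X.epi_universalToTriv_one (universalLift h) h.g (universalToTriv_one_comp h) n).choose_spec))

lemma maximalProj_lift {N : Calc V} (h : X ⟶ (truncation V).obj N) (n : ℕ) :
    X.maximalProj.φ.f n ≫ (maximalLift h).hom.φ.f n = (universalLift h).φ.f n :=
  (exists_factor_prolongProj X.universalToTriv X.isIso_universalToTriv_zero
    X.epi_universalToTriv_one (universalLift h) h.g (universalToTriv_one_comp h) n).choose_spec

lemma toMaximal_lift {N : Calc V} (h : X ⟶ (truncation V).obj N) :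
    X.toMaximal ≫ (truncation V).map (maximalLift h) = h := by
  refine Hom.ext (Mon.Hom.ext (maximalProj_lift h 0)) ?_
  have := X.epi_universalToTriv_one
  refine (Category.id_comp ((maximalLift h).hom.φ.f 1)).trans ?_
  refine (cancel_epi (X.universalToTriv.φ.f 1)).1 ?_
  exact (maximalProj_lift h 1).trans (universalToTriv_one_comp h).symm

lemma bijective_toMaximal_comp (X : Calc1 V) (N : Calc V) :
    Function.Bijective fun φ : X.maximal ⟶ N => X.toMaximal ≫ (truncation V).map φ := by
  refine ⟨fun φ ψ h => ?_, fun h => ⟨maximalLift h, toMaximal_lift h⟩⟩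
  refine ObjectProperty.hom_ext _ (DGAlgebra.Hom.ext_zero
    (X.maximal.obj.epi_mulD X.maximal.property) ?_)
  have h' := congrArg (fun k : X ⟶ (truncation V).obj N => k.f.hom) h
  exact (Category.id_comp _).symm.trans (h'.trans (Category.id_comp _))

end Calc1

end Maximal

/-! ### The trivial extension -/

section Trivial

variable {V : Type u} [Category.{v} V] [MonoidalCategory V] [Preadditive V] [HasFiniteLimits V]

namespace Calc1

/-- The identification of the truncation of the trivial extension with the calculus. -/
noncomputable def ofTrivial (X : Calc1 V) : (truncation V).obj X.trivialExtension ⟶ X where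
  f := Mon.Hom.mk' (𝟙 X.A.X) (Category.comp_id _) (comp_id_eq_id_tensorHom_comp rfl)
  g := 𝟙 X.Ω.X
  actLeft_comm := comp_id_eq_id_tensorHom_comp rfl
  actRight_comm := comp_id_eq_id_tensorHom_comp rfl
  d_comm := (Category.comp_id _).trans (Category.id_comp _).symm

/-- The components of the morphism to the trivial extension induced by a morphism of first order
calculi. -/
noncomputable def trivialLiftF {M : Calc V} {X : Calc1 V} (h : (truncation V).obj M ⟶ X) :
    (n : ℕ) → (M.obj.K.X n ⟶ X.trivX n)
  | 0 => h.f.hom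
  | 1 => h.g
  | _ + 2 => 0

/-- The morphism to the trivial extension induced by a morphism of first order calculi. -/
noncomputable def trivialLift {M : Calc V} {X : Calc1 V} (h : (truncation V).obj M ⟶ X) :
    M ⟶ X.trivialExtension :=
  ObjectProperty.homMk
    { φ := CochainComplex.ofHom (Y := X.trivK) (trivialLiftF h) (fun n => match n with
        | 0 => h.d_comm.symm
        | _ + 1 => isZero_terminal.eq_of_tgt _ _)
      one_comm := h.f.isMonHom_hom.one_hom
      wedge_comm := fun i j n e => match i, j, n, e with
        | _, _, _ + 2, _ => isZero_terminal.eq_of_tgt _ _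
        | 0, 0, 0, _ => h.f.isMonHom_hom.mul_hom
        | 0, 1, 1, _ => h.actLeft_comm
        | 1, 0, 1, _ => h.actRight_comm
        | 0, 0, 1, e | 0, _ + 1, 0, e | 0, _ + 2, 1, e | _ + 1, _, 0, e | 1, _ + 1, 1, e
        | _ + 2, _, 1, e => by exfalso; omega }

lemma bijective_comp_ofTrivial (M : Calc V) (X : Calc1 V) :
    Function.Bijective fun φ : M ⟶ X.trivialExtension => (truncation V).map φ ≫ X.ofTrivial := by
  refine ⟨fun φ ψ h => ?_, fun h => ⟨trivialLift h, ?_⟩⟩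
  · refine ObjectProperty.hom_ext _ (DGAlgebra.Hom.ext_zero (M.obj.epi_mulD M.property) ?_)
    have h' := congrArg (fun k : (truncation V).obj M ⟶ X => k.f.hom) h
    exact (Category.comp_id _).symm.trans (h'.trans (Category.comp_id _))
  · exact Hom.ext (Mon.Hom.ext (Category.comp_id h.f.hom)) (Category.comp_id h.g)

end Calc1

end Trivial

end NCCalc

theorem mainTheorem3 {V : Type u} [Category.{v} V] [MonoidalCategory V] [Preadditive V]
    [MonoidalPreadditive V] [HasFiniteLimits V] [HasFiniteColimits V]
    [∀ X : V, PreservesFiniteColimits (tensorLeft X)]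
    [∀ X : V, PreservesFiniteColimits (tensorRight X)] :
    (∃ (R : NCCalc.Calc1 V ⥤ NCCalc.Calc V) (_ : NCCalc.truncation V ⊣ R),
      ∀ X : NCCalc.Calc1 V, R.obj X = X.trivialExtension) ∧
    (∃ (L : NCCalc.Calc1 V ⥤ NCCalc.Calc V) (adj : L ⊣ NCCalc.truncation V),
      ∀ X : NCCalc.Calc1 V, NCCalc.IsMaximalProlongation (adj.unit.app X)) := by
  constructor
  · let e (M : NCCalc.Calc V) (X : NCCalc.Calc1 V) :
        ((NCCalc.truncation V).obj M ⟶ X) ≃ (M ⟶ X.trivialExtension) :=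
      (Equiv.ofBijective _ (NCCalc.Calc1.bijective_comp_ofTrivial M X)).symm
    have he (M' M : NCCalc.Calc V) (X : NCCalc.Calc1 V) (f : M' ⟶ M)
        (g : (NCCalc.truncation V).obj M ⟶ X) :
        e M' X ((NCCalc.truncation V).map f ≫ g) = f ≫ e M X g := by
      have h : (NCCalc.truncation V).map (e M X g) ≫ X.ofTrivial = g :=
        (e M X).symm_apply_apply g
      refine (Equiv.symm_apply_eq _).2 ?_
      change _ = (NCCalc.truncation V).map (f ≫ e M X g) ≫ X.ofTrivial
      rw [CategoryTheory.Functor.map_comp, Category.assoc, h]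
    exact ⟨_, Adjunction.adjunctionOfEquivRight e he, fun _ => rfl⟩
  · let e (X : NCCalc.Calc1 V) (N : NCCalc.Calc V) :
        (X.maximal ⟶ N) ≃ (X ⟶ (NCCalc.truncation V).obj N) :=
      Equiv.ofBijective _ (NCCalc.Calc1.bijective_toMaximal_comp X N)
    have he (X : NCCalc.Calc1 V) (N N' : NCCalc.Calc V) (g : N ⟶ N') (h : X.maximal ⟶ N) :
        e X N' (h ≫ g) = e X N h ≫ (NCCalc.truncation V).map g := by
      change X.toMaximal ≫ _ = (X.toMaximal ≫ _) ≫ _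
      rw [CategoryTheory.Functor.map_comp, Category.assoc]
    refine ⟨_, Adjunction.adjunctionOfEquivLeft e he, fun X => ?_⟩
    -- The unit corresponds to the identity of `X.maximal` under the bijection of morphism sets.
    have h : (Adjunction.adjunctionOfEquivLeft e he).unit.app X = X.toMaximal := by
      rw [← Adjunction.homEquiv_id, Adjunction.adjunctionOfEquivLeft,
        Adjunction.mkOfHomEquiv_homEquiv]
      change X.toMaximal ≫ (NCCalc.truncation V).map (𝟙 X.maximal) = X.toMaximal
      rw [CategoryTheory.Functor.map_id, Category.comp_id]
    rw [h]
    exact X.isMaximalProlongation_toMaximal
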